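/- **Proposition (Behavior of nearest neighbors).** Let $1\le d<m$. Let $M\subseteq\mathbb{R}^m$ be an embedded $C^2$ submanifold of dimension $d$ with $0\in M$, with the Riemannian metric induced by the Euclidean inner product, and let $\mathrm{vol}_M$ be its volume measure (equivalently, the $d$-dimensional Hausdorff measure restricted to $M$, normalized to be Lebesgue measure on $\mathbb{R}^d$). Let $g\ge 0$ be a Borel function on $M$ which is Lipschitz on $M\cap B_\varepsilon(0)$ for some $\varepsilon>0$ and satisfies $g(0)>0$. Let $P$ be a Borel probability measure on $\mathbb{R}^m$ which, on the open ball $B_\rho(0)$ for some $\rho\in(0,\infty]$, is carried by $M$ with density $g$: $P(D)=\int_{D\cap M}g\,d\mathrm{vol}_M$ for all Borel sets $D\subseteq B_\rho(0)$. Let $X_1,X_2,\dots$ be i.i.d. random vectors with law $P$. For $0\le k<n$ let $L_{k+1,n}$ be the Euclidean distance from $0$ to its $(k+1)$-st nearest neighbor in the sample $X_1,\dots,X_n$, and let $(Y_1,\dots,Y_k)$ be the $k$ nearest neighbors of $0$ in this sample, listed in the order in which they occur in the sample (ties in distance are broken by the index). Then: 1. There are a constant $C_0>0$ and deterministic functions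 $r(n)=r_{g(0),C}(n)$, depending only on $m$, $d$, on the value $g(0)$ of the density at $0$, and on $C$, such that for every $C\ge C_0$ $$r(n)=O\left(\left(\frac{\log n}{n}\right)^{1/d}\right)\qquad(n\to\infty),$$ and such that, with $k(n)=\lceil C\log n\rceil$ and $R(n)=L_{k(n)+1,n}$, with probability one there is an $n_0$ (depending on the sample) such that $k(n)<n$ and $R(n)\le r(n)$ for all $n\ge n_0$. The constant $C_0$ depends only on $m$ and $d$. 2. There is $\rho_0>0$ such that $P(\|x\|=s)=0$ for all $s<\rho_0$. For all integers $0\le k<n$ (in particular for $k=\lceil C\log n\rceil$ with any $C>0$, whenever $k<n$), and for almost every value $s$ of $R=L_{k+1,n}$ with $s<\rho$ and $P(\|x\|=s)=0$, the conditional distribution of $(Y_1,\dots,Y_k)$ given $R=s$ is that of an i.i.d. sample of size $k$ from the law which has, with respect to $\mathrm{vol}_M$, the density $$g_s=\frac{g\,\mathbf 1_{M\cap B_s(0)}}{\int_{M\cap B_s(0)}g\,d\mathrm{vol}_M},$$ the normalized restriction of $g$ to $M\cap B_s(0)$, where $B_s(0)$ is the open ball of radius $s$ in $\mathbb{R}^m$.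 -/

import Mathlib

open MeasureTheory ProbabilityTheory Filter Asymptotics
open scoped Topology ENNReal

/-- `M` is an (embedded) `C²` submanifold of dimension `d` of `ℝᵐ`: around each of its points there
is a `C²` diffeomorphism between open subsets of `ℝᵐ` which carries `M` to the coordinate
subspace `ℝᵈ × {0}`. -/
def IsC2Submanifold {m : ℕ} (d : ℕ) (M : Set (EuclideanSpace ℝ (Fin m))) : Prop :=
  ∀ x ∈ M, ∃ Φ : OpenPartialHomeomorph (EuclideanSpace ℝ (Fin m)) (EuclideanSpace ℝ (Fin m)),
    x ∈ Φ.source ∧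
    ContDiffOn ℝ 2 Φ Φ.source ∧
    ContDiffOn ℝ 2 Φ.symm Φ.target ∧
    Φ.IsImage M {y | ∀ i : Fin m, d ≤ (i : ℕ) → y i = 0}

/-- The volume measure of a `d`-dimensional submanifold `M` of `ℝᵐ` (with the Riemannian metric
induced by the Euclidean inner product), seen as a measure on `ℝᵐ` carried by `M`: the
`d`-dimensional Hausdorff measure, normalized to be Lebesgue measure on `ℝᵈ`, restricted to `M`. -/
noncomputable def submanifoldVolume {m : ℕ} (d : ℕ) (M : Set (EuclideanSpace ℝ (Fin m))) :
    Measure (EuclideanSpace ℝ (Fin m)) :=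
  (Measure.euclideanHausdorffMeasure d).restrict M

/-- The measure `g • vol_M` with density `g` with respect to the volume measure of `M`. -/
noncomputable def densityMeasure {m : ℕ} (d : ℕ) (M : Set (EuclideanSpace ℝ (Fin m)))
    (g : EuclideanSpace ℝ (Fin m) → ℝ) : Measure (EuclideanSpace ℝ (Fin m)) :=
  (submanifoldVolume d M).withDensity (fun x => ENNReal.ofReal (g x))

/-- The normalized restriction of `g` to `M ∩ B_s(0)`, where `B_s(0)` is the open ball. -/
noncomputable def restrictedDensity {m : ℕ} (d : ℕ) (M : Set (EuclideanSpace ℝ (Fin m)))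
    (g : EuclideanSpace ℝ (Fin m) → ℝ) (s : ℝ) (x : EuclideanSpace ℝ (Fin m)) : ℝ≥0∞ :=
  (M ∩ Metric.ball 0 s).indicator (fun y => ENNReal.ofReal (g y)) x /
    ∫⁻ y in M ∩ Metric.ball 0 s, ENNReal.ofReal (g y) ∂(submanifoldVolume d M)

/-- The law on `ℝᵐ` whose density with respect to the volume measure of `M` is the normalized
restriction of `g` to `M ∩ B_s(0)`. -/
noncomputable def restrictedLaw {m : ℕ} (d : ℕ) (M : Set (EuclideanSpace ℝ (Fin m)))
    (g : EuclideanSpace ℝ (Fin m) → ℝ) (s : ℝ) : Measure (EuclideanSpace ℝ (Fin m)) :=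
  (submanifoldVolume d M).withDensity (restrictedDensity d M g s)

/-- The permutation that lists the points of the sample `x` by increasing distance to the origin:
`nnOrder x 0` is the index of the nearest neighbour of `0`, `nnOrder x 1` that of the second
nearest one, and so on (ties are broken by the index). -/
noncomputable def nnOrder {m n : ℕ} (x : Fin n → EuclideanSpace ℝ (Fin m)) :
    Equiv.Perm (Fin n) :=
  Tuple.sort (fun i => ‖x i‖)

/-- The distance from `0` to its `(k+1)`-st nearest neighbour in the sample `x`, for `k < n`. -/
noncomputable def nnDist {m n : ℕ} (x : Fin n → EuclideanSpace ℝ (Fin m)) (k : ℕ) (hk : k < n) :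
    ℝ :=
  ‖x (nnOrder x ⟨k, hk⟩)‖

/-- The set of the indices of the `k` nearest neighbours of `0` in the sample `x`. -/
noncomputable def nnIndices {m n : ℕ} (x : Fin n → EuclideanSpace ℝ (Fin m)) (k : ℕ)
    (hk : k < n) : Finset (Fin n) :=
  Finset.univ.map ((Fin.castLEEmb hk.le).trans (nnOrder x).toEmbedding)

theorem card_nnIndices {m n : ℕ} (x : Fin n → EuclideanSpace ℝ (Fin m)) (k : ℕ) (hk : k < n) :
    (nnIndices x k hk).card = k := by
  simp [nnIndices]

/-- The `k` nearest neighbours of `0` in the sample `x`, as a `k`-tuple of points listed in the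
order in which they occur in the sample (not by distance). -/
noncomputable def nearestNeighbors {m n : ℕ} (x : Fin n → EuclideanSpace ℝ (Fin m)) (k : ℕ)
    (hk : k < n) : Fin k → EuclideanSpace ℝ (Fin m) :=
  fun i => x ((nnIndices x k hk).orderEmbOfFin (card_nnIndices x k hk) i)

/-! Near 0 the manifold is parametrized by a map σ on a ball of ℝᵈ whose increments differ from
those of a linear isometry by at most a quarter of the length. So σ distorts lengths by absolute
factors, and M has volume at least κ rᵈ in a small ball of radius r, with κ = `ballVolumeConst d`
independent of M. As g > g(0)/2 near 0, P(B_r) ≥ κ (g(0)/2) rᵈ for small r. How small depends on M,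
g and P, but this affects only n₀, not r(n).

For part 1, let r(n)ᵈ be the multiple of log n / n for which B_{r(n)} has expected count at least 6
C log n. By a Chernoff bound the probability that at most ⌈C log n⌉ sample points fall there is
O(n⁻²), and Borel–Cantelli concludes (`ae_eventually_nnDist_le`).

For part 2, ‖σ‖ increases strictly along rays, so small spheres pull back to sets meeting each ray
at most once, which are null. At distances where spheres are null there are almost surely no ties,
and the sample space splits according to the index j of the (k+1)-st neighbor and the set S of the k
nearer indices. Freezing x_j, Fubini leaves independent coordinates: those in S are constrained to
the open ball of radius ‖x_j‖, the others to the outside of its closure. Those in S are thus i.i.d.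
from P conditioned on the ball, whatever (j, S) is (`setLIntegral_strictNeighbor`). Summing over (j,
S) identifies the conditional distribution, and inside B_ρ the conditioned law is the normalized
restriction of g. -/

/-! ### Coordinates and a nearly isometric local parametrization -/

/-- The inclusion of `ℝᵈ` in `ℝᵐ` as the subspace of the first `d` coordinates. -/
noncomputable def coordInclusion (d m : ℕ) :
    EuclideanSpace ℝ (Fin d) →L[ℝ] EuclideanSpace ℝ (Fin m) :=
  LinearMap.toContinuousLinearMap
    { toFun := fun w => WithLp.toLp 2 fun i => if h : (i : ℕ) < d then w ⟨i, h⟩ else 0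
      map_add' := fun v w => by ext i; by_cases h : (i : ℕ) < d <;> simp [h]
      map_smul' := fun c w => by ext i; by_cases h : (i : ℕ) < d <;> simp [h] }

/-- The projection of `ℝᵐ` onto the first `d` coordinates. -/
noncomputable def coordProjection {d m : ℕ} (h : d ≤ m) :
    EuclideanSpace ℝ (Fin m) →L[ℝ] EuclideanSpace ℝ (Fin d) :=
  LinearMap.toContinuousLinearMap
    { toFun := fun y => WithLp.toLp 2 fun i => y (Fin.castLE h i)
      map_add' := fun v w => by ext i; simp
      map_smul' := fun c w => by ext i; simp }

theorem coordInclusion_apply {d m : ℕ} (w : EuclideanSpace ℝ (Fin d)) (i : Fin m) :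
    coordInclusion d m w i = if h : (i : ℕ) < d then w ⟨i, h⟩ else 0 := rfl

theorem coordProjection_apply {d m : ℕ} (h : d ≤ m) (y : EuclideanSpace ℝ (Fin m)) (i : Fin d) :
    coordProjection h y i = y (Fin.castLE h i) := rfl

theorem coordProjection_coordInclusion {d m : ℕ} (h : d ≤ m) (w : EuclideanSpace ℝ (Fin d)) :
    coordProjection h (coordInclusion d m w) = w := by
  ext i
  simp [coordProjection_apply, coordInclusion_apply]

theorem coordInclusion_coordProjection {d m : ℕ} (h : d ≤ m) {y : EuclideanSpace ℝ (Fin m)}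
    (hy : ∀ i : Fin m, d ≤ (i : ℕ) → y i = 0) :
    coordInclusion d m (coordProjection h y) = y := by
  ext i
  rw [coordInclusion_apply]
  split_ifs with hi
  · rfl
  · exact (hy i (not_lt.mp hi)).symm

/-- In each chart domain M is the preimage of a closed subspace. So M is relatively closed in the
open union of these domains, hence Borel. -/
theorem IsC2Submanifold.measurableSet {m d : ℕ} {M : Set (EuclideanSpace ℝ (Fin m))}
    (hM : IsC2Submanifold d M) : MeasurableSet M := by
  choose Φ hx _ _ hI using fun x : M => hM x x.2
  have hN : IsClosed {y : EuclideanSpace ℝ (Fin m) | ∀ i : Fin m, d ≤ (i : ℕ) → y i = 0} := by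
    simp only [Set.ofPred_forall]
    exact isClosed_iInter fun i => isClosed_iInter fun _ =>
      isClosed_eq (by fun_prop) continuous_const
  have hopen : IsOpen (⋃ x, (Φ x).source) := isOpen_iUnion fun x => (Φ x).open_source
  have hopen' : IsOpen (⋃ x, ((Φ x).source ∩ Mᶜ)) := by
    refine isOpen_iUnion fun x => ?_
    rw [← (hI x).compl.preimage_eq]
    exact (Φ x).isOpen_inter_preimage hN.isOpen_compl
  have : M = (⋃ x, (Φ x).source) \ ⋃ x, ((Φ x).source ∩ Mᶜ) := by
    ext y
    simp only [Set.mem_sdiff, Set.mem_iUnion, Set.mem_inter_iff, Set.mem_compl_iff]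
    constructor
    · intro hy
      exact ⟨⟨⟨y, hy⟩, hx ⟨y, hy⟩⟩, by rintro ⟨_, _, h⟩; exact h hy⟩
    · rintro ⟨⟨x, hyx⟩, h⟩
      by_contra hy
      exact h ⟨x, hyx, hy⟩
  rw [this]
  exact hopen.measurableSet.diff hopen'.measurableSet

/-- Near a point, an injective linear map can be precomposed with a linear automorphism to become
an isometric embedding. -/
theorem exists_linearIsometry_comp {d : ℕ} {E : Type*} [NormedAddCommGroup E]
    [InnerProductSpace ℝ E] (B : EuclideanSpace ℝ (Fin d) →L[ℝ] E) (hB : Function.Injective B) :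
    ∃ (L : EuclideanSpace ℝ (Fin d) ≃L[ℝ] EuclideanSpace ℝ (Fin d))
      (J : EuclideanSpace ℝ (Fin d) →ₗᵢ[ℝ] E), ∀ w, B (L w) = J w := by
  let e₁ := LinearEquiv.ofInjective (B : EuclideanSpace ℝ (Fin d) →ₗ[ℝ] E) hB
  have hfin : Module.finrank ℝ (LinearMap.range (B : EuclideanSpace ℝ (Fin d) →ₗ[ℝ] E)) = d := by
    rw [← e₁.finrank_eq]; simp
  let e := ((stdOrthonormalBasis ℝ
    (LinearMap.range (B : EuclideanSpace ℝ (Fin d) →ₗ[ℝ] E))).reindex (finCongr hfin)).repr.symm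
  refine ⟨(e.toLinearEquiv.trans e₁.symm).toContinuousLinearEquiv,
    (Submodule.subtypeₗᵢ _).comp e.toLinearIsometry, fun w => ?_⟩
  have : (e₁ (e₁.symm (e w)) : E) = e w := by rw [e₁.apply_symm_apply]
  exact this

/-- A submanifold through the origin has, near the origin, a parametrization which is close to an
isometric linear embedding. -/
theorem IsC2Submanifold.exists_parametrization {m d : ℕ} (hdm : d ≤ m)
    {M : Set (EuclideanSpace ℝ (Fin m))} (hM : IsC2Submanifold d M) (h0 : 0 ∈ M) :
    ∃ (σ : EuclideanSpace ℝ (Fin d) → EuclideanSpace ℝ (Fin m))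
      (J : EuclideanSpace ℝ (Fin d) →ₗᵢ[ℝ] EuclideanSpace ℝ (Fin m)) (δ : ℝ), 0 < δ ∧ σ 0 = 0 ∧
      ApproximatesLinearOn σ J.toContinuousLinearMap (Metric.closedBall 0 δ) (1 / 4) ∧
      (∀ w ∈ Metric.closedBall 0 δ, σ w ∈ M) ∧
      ∃ η : ℝ, 0 < η ∧ M ∩ Metric.ball 0 η ⊆ σ '' Metric.closedBall 0 δ := by
  obtain ⟨Φ, hs, hΦ, hΨ, hI⟩ := hM 0 h0
  have ht : Φ 0 ∈ Φ.target := Φ.map_source hs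
  have hΨ' : HasStrictFDerivAt Φ.symm (fderiv ℝ Φ.symm (Φ 0)) (Φ 0) :=
    (hΨ.contDiffAt (Φ.open_target.mem_nhds ht)).hasStrictFDerivAt (by norm_num)
  have hΦ' : HasStrictFDerivAt Φ (fderiv ℝ Φ 0) 0 :=
    (hΦ.contDiffAt (Φ.open_source.mem_nhds hs)).hasStrictFDerivAt (by norm_num)
  have hinv : (fderiv ℝ Φ 0).comp (fderiv ℝ Φ.symm (Φ 0)) = ContinuousLinearMap.id ℝ _ := by
    have h1 : HasFDerivAt Φ (fderiv ℝ Φ 0) (Φ.symm (Φ 0)) := by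
      rw [Φ.left_inv hs]; exact hΦ'.hasFDerivAt
    refine (h1.comp (Φ 0) hΨ'.hasFDerivAt).unique ((hasFDerivAt_id (Φ 0)).congr_of_eventuallyEq ?_)
    filter_upwards [Φ.open_target.mem_nhds ht] with y hy
    simp [Φ.right_inv hy]
  -- The derivative of the chart is a left inverse of that of its inverse, so the latter stays
  -- injective on the coordinate subspace.
  have hBinj : Function.Injective ((fderiv ℝ Φ.symm (Φ 0)).comp (coordInclusion d m)) := by
    refine Function.LeftInverse.injective
      (g := fun y => coordProjection hdm (fderiv ℝ Φ 0 y)) fun w => ?_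
    have := DFunLike.congr_fun hinv (coordInclusion d m w)
    simp only [ContinuousLinearMap.comp_apply, ContinuousLinearMap.id_apply] at this ⊢
    rw [this, coordProjection_coordInclusion]
  obtain ⟨L, J, hJ⟩ := exists_linearIsometry_comp _ hBinj
  have hp : ∀ i : Fin m, d ≤ (i : ℕ) → Φ 0 i = 0 := (hI hs).2 h0
  -- The chart need not fix 0, hence the translation by `Φ 0`; precomposing with `L` turns the
  -- derivative at 0 into the isometry `J`.
  set σ : EuclideanSpace ℝ (Fin d) → EuclideanSpace ℝ (Fin m) :=
    fun w => Φ.symm (Φ 0 + coordInclusion d m (L w)) with hσ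
  have hσd : HasStrictFDerivAt σ J.toContinuousLinearMap 0 := by
    have h1 : HasStrictFDerivAt (fun w => Φ 0 + coordInclusion d m (L w))
        ((coordInclusion d m).comp (L : _ →L[ℝ] _)) 0 :=
      HasStrictFDerivAt.const_add (Φ 0) (((coordInclusion d m).comp
        (L : EuclideanSpace ℝ (Fin d) →L[ℝ] EuclideanSpace ℝ (Fin d))).hasStrictFDerivAt)
    have h2 : HasStrictFDerivAt Φ.symm (fderiv ℝ Φ.symm (Φ 0))
        (Φ 0 + coordInclusion d m (L 0)) := by simpa using hΨ'
    convert! h2.comp (0 : EuclideanSpace ℝ (Fin d)) h1 using 1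
    ext1 w
    exact (hJ w).symm
  obtain ⟨s, hs0, happ⟩ := hσd.approximates_deriv_on_nhds (c := 1 / 4) (Or.inr (by norm_num))
  have htgt : ∀ᶠ w in 𝓝 (0 : EuclideanSpace ℝ (Fin d)), Φ 0 + coordInclusion d m (L w) ∈ Φ.target := by
    have : Tendsto (fun w => Φ 0 + coordInclusion d m (L w)) (𝓝 0) (𝓝 (Φ 0)) := by
      have h : Continuous fun w => Φ 0 + coordInclusion d m (L w) := by fun_prop
      simpa using h.tendsto 0
    exact this (Φ.open_target.mem_nhds ht)
  obtain ⟨δ, hδ, hball⟩ := Metric.nhds_basis_closedBall.mem_iff.1 (inter_mem hs0 htgt)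
  refine ⟨σ, J, δ, hδ, by simp [hσ, Φ.left_inv hs], happ.mono_set fun w hw => (hball hw).1, ?_, ?_⟩
  · intro w hw
    refine (hI.symm_apply_mem_iff (hball hw).2).2 fun i hi => ?_
    simp [hp i hi, coordInclusion_apply, not_lt.2 hi]
  -- The parameter of a point x of M is read off from `Φ x`; it depends continuously on x, so it
  -- lies in the δ-ball when x is near 0.
  · have hcont : Tendsto (fun x => L.symm (coordProjection hdm (Φ x - Φ 0))) (𝓝 0) (𝓝 0) := by
      have h1 : Tendsto (fun x => Φ x - Φ 0) (𝓝 0) (𝓝 0) := by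
        simpa using (Φ.continuousAt hs).tendsto.sub_const (Φ 0)
      have h : Continuous fun y => L.symm (coordProjection hdm y) := by fun_prop
      have h' := h.tendsto 0
      simp only [map_zero] at h'
      exact h'.comp h1
    obtain ⟨η, hη, hsub⟩ := Metric.nhds_basis_ball.mem_iff.1
      (inter_mem (hcont (Metric.closedBall_mem_nhds 0 hδ)) (Φ.open_source.mem_nhds hs))
    refine ⟨η, hη, fun x hx => ⟨_, (hsub hx.2).1, ?_⟩⟩
    have hxs := (hsub hx.2).2
    have hxN : ∀ i : Fin m, d ≤ (i : ℕ) → Φ x i = 0 := (hI hxs).2 hx.1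
    rw [hσ]
    simp only [ContinuousLinearEquiv.apply_symm_apply]
    rw [coordInclusion_coordProjection hdm fun i hi => by simp [hp i hi, hxN i hi],
      add_sub_cancel, Φ.left_inv hxs]

/-! ### Metric consequences of being close to an isometry -/

namespace ApproximatesLinearOn

variable {V E : Type*} [NormedAddCommGroup V] [InnerProductSpace ℝ V] [NormedAddCommGroup E]
  [InnerProductSpace ℝ E] {σ : V → E} {J : V →ₗᵢ[ℝ] E} {s : Set V}

theorem norm_sub_le_of_isometry
    (h : ApproximatesLinearOn σ J.toContinuousLinearMap s (1 / 4)) {x y : V} (hx : x ∈ s)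
    (hy : y ∈ s) : ‖σ x - σ y‖ ≤ 5 / 4 * ‖x - y‖ := by
  have h1 := h x hx y hy
  have h2 : ‖J.toContinuousLinearMap (x - y)‖ = ‖x - y‖ := J.norm_map _
  have h3 := norm_le_norm_add_norm_sub' (σ x - σ y) (J.toContinuousLinearMap (x - y))
  rw [h2] at h3
  push_cast at h1
  linarith

theorem norm_sub_ge_of_isometry
    (h : ApproximatesLinearOn σ J.toContinuousLinearMap s (1 / 4)) {x y : V} (hx : x ∈ s)
    (hy : y ∈ s) : ‖x - y‖ ≤ 2 * ‖σ x - σ y‖ := by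
  have h1 := h x hx y hy
  have h2 : ‖J.toContinuousLinearMap (x - y)‖ = ‖x - y‖ := J.norm_map _
  have h3 := norm_le_norm_add_norm_sub (σ x - σ y) (J.toContinuousLinearMap (x - y))
  rw [h2] at h3
  push_cast at h1
  linarith [norm_nonneg (x - y)]

/-- A map close to a linear isometry has strictly increasing norm along rays. -/
theorem norm_lt_norm_smul
    (h : ApproximatesLinearOn σ J.toContinuousLinearMap s (1 / 4)) (h0 : (0 : V) ∈ s)
    (hσ : σ 0 = 0) {w : V} {t : ℝ} (ht : 1 < t) (hw0 : w ≠ 0) (hw : w ∈ s) (htw : t • w ∈ s) :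
    ‖σ w‖ < ‖σ (t • w)‖ := by
  have hpos : 0 < ‖w‖ := norm_pos_iff.2 hw0
  have h1 := h w hw 0 h0
  have h2 := h (t • w) htw w hw
  have hJ : ‖J w‖ = ‖w‖ := J.norm_map w
  simp only [hσ, sub_zero, LinearIsometry.coe_toContinuousLinearMap] at h1 h2
  have ht' : t • w - w = (t - 1) • w := by rw [sub_smul, one_smul]
  rw [ht', J.map_smul, norm_smul, Real.norm_of_nonneg (by linarith)] at h2
  push_cast at h1 h2
  set a := σ w
  set b := σ (t • w)
  set e₁ := a - J w with he₁
  set e₂ := b - a - (t - 1) • J w with he₂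
  -- This expands ⟨a, b - a⟩ with a = Jw + e₁ and b - a = (t - 1) Jw + e₂. The errors cost at most
  -- (1/4 + 1/4 + 1/16) of the main term (t - 1)‖w‖², so ‖a‖² < ⟨a, b⟩, and Cauchy–Schwarz gives ‖a‖
  -- < ‖b‖.
  have hab : ‖J w‖ ^ 2 * (t - 1) + (t - 1) * inner ℝ (J w) e₁ + inner ℝ (J w) e₂ + inner ℝ e₁ e₂
      = inner ℝ a b - ‖a‖ ^ 2 := by
    have ha : a = J w + e₁ := by rw [he₁]; abel
    have hb : b = a + (t - 1) • J w + e₂ := by rw [he₂]; abel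
    rw [hb, inner_add_right, inner_add_right, real_inner_self_eq_norm_sq, real_inner_smul_right]
    nth_rw 2 [ha]
    nth_rw 2 [ha]
    rw [inner_add_left, inner_add_left, real_inner_self_eq_norm_sq, real_inner_comm e₁ (J w)]
    ring
  have i1 := neg_le_of_abs_le (abs_real_inner_le_norm (J w) e₁)
  have i2 := neg_le_of_abs_le (abs_real_inner_le_norm (J w) e₂)
  have i3 := neg_le_of_abs_le (abs_real_inner_le_norm e₁ e₂)
  rw [hJ] at i1 i2 hab
  have ht1 : 0 < t - 1 := by linarith
  have j1 : ‖w‖ * ‖e₁‖ ≤ ‖w‖ * (1 / 4 * ‖w‖) := by gcongr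
  have j2 : ‖w‖ * ‖e₂‖ ≤ ‖w‖ * (1 / 4 * ((t - 1) * ‖w‖)) := by gcongr
  have j3 : ‖e₁‖ * ‖e₂‖ ≤ (1 / 4 * ‖w‖) * (1 / 4 * ((t - 1) * ‖w‖)) := by gcongr
  have j4 : (t - 1) * (-(‖w‖ * (1 / 4 * ‖w‖))) ≤ (t - 1) * inner ℝ (J w) e₁ := by
    gcongr; linarith
  have hp : 0 < (t - 1) * ‖w‖ ^ 2 := by positivity
  have key : ‖a‖ ^ 2 < inner ℝ a b := by nlinarith
  have := real_inner_le_norm a b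
  by_contra! hle
  nlinarith [norm_nonneg a, mul_le_mul_of_nonneg_left hle (norm_nonneg a)]

end ApproximatesLinearOn

/-! ### Volume of small balls and spheres in the submanifold -/

open scoped Pointwise in
/-- A bounded measurable set which meets every ray from the origin at most once is null. -/
theorem addHaar_eq_zero_of_rays {V : Type*} [NormedAddCommGroup V] [NormedSpace ℝ V]
    [MeasurableSpace V] [BorelSpace V] [FiniteDimensional ℝ V] (ν : Measure V)
    [ν.IsAddHaarMeasure] {S : Set V} (hS : MeasurableSet S) {δ : ℝ}
    (hb : S ⊆ Metric.closedBall 0 δ)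
    (hray : ∀ w ∈ S, ∀ t : ℝ, 1 < t → t • w ∉ S) : ν S = 0 := by
  -- Distinct factors in (1, 2]: the dilates of S are pairwise disjoint by the ray condition, have
  -- measure at least ν S, and all lie in one ball of finite measure. Infinitely many fit only if ν
  -- S = 0.
  set c : ℕ → ℝ := fun n => 1 + 1 / ((n : ℝ) + 1) with hc
  have hc1 : ∀ n, 1 < c n := fun n => by
    have : 0 < 1 / ((n : ℝ) + 1) := by positivity
    simp only [hc]; linarith
  have hc2 : ∀ n, c n ≤ 2 := fun n => by
    have : 1 / ((n : ℝ) + 1) ≤ 1 := by rw [div_le_one (by positivity)]; simp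
    simp only [hc]; linarith
  have hanti : StrictAnti c := fun i j hij => by
    simp only [hc]; gcongr
  have key : ∀ i j, c j < c i → ∀ w ∈ S, ∀ w' ∈ S, c i • w ≠ c j • w' := by
    intro i j hij w hw w' hw' heq
    have hj : 0 < c j := one_pos.trans (hc1 j)
    have hlt : 1 < c i / c j := (one_lt_div hj).2 hij
    apply hray w hw _ hlt
    rw [div_eq_inv_mul, mul_smul, heq, smul_smul, inv_mul_cancel₀ hj.ne', one_smul]
    exact hw'
  have hdisj : Pairwise (Function.onFun Disjoint fun n => c n • S) := by
    intro i j hij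
    refine Set.disjoint_left.2 ?_
    rintro _ ⟨w, hw, rfl⟩ ⟨w', hw', heq⟩
    simp only at heq
    rcases lt_or_gt_of_ne (hanti.injective.ne hij) with h | h
    · exact key j i h w' hw' w hw heq
    · exact key i j h w hw w' hw' heq.symm
  have hsum : ∑' _ : ℕ, ν S ≤ ν (Metric.closedBall 0 (2 * δ)) := by
    calc ∑' _ : ℕ, ν S ≤ ∑' n : ℕ, ν (c n • S) := by
          refine ENNReal.tsum_le_tsum fun n => ?_
          rw [Measure.addHaar_smul]
          refine le_mul_of_one_le_left (zero_le) ?_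
          rw [ENNReal.one_le_ofReal, abs_of_nonneg (by have := hc1 n; positivity)]
          exact one_le_pow₀ (hc1 n).le
      _ = ν (⋃ n, c n • S) :=
          (measure_iUnion hdisj fun n =>
            hS.const_smul₀ (c n)).symm
      _ ≤ _ := by
          refine measure_mono (Set.iUnion_subset fun n => ?_)
          rintro _ ⟨w, hw, rfl⟩
          have := mem_closedBall_zero_iff.1 (hb hw)
          have h1 := hc1 n
          simp only [mem_closedBall_zero_iff, norm_smul]
          rw [Real.norm_of_nonneg (by linarith)]
          have := hc2 n
          gcongr
  by_contra hne
  rw [ENNReal.tsum_const_eq_top_of_ne_zero hne] at hsum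
  exact absurd hsum (not_le.2 measure_closedBall_lt_top)

/-- A lower bound, depending on `d` only, for the volume of small balls of radius `r` in a
`d`-dimensional submanifold, divided by `r ^ d`. -/
noncomputable def ballVolumeConst (d : ℕ) : ℝ :=
  volume.real (Metric.ball (0 : EuclideanSpace ℝ (Fin d)) 1) / 4 ^ d

theorem ballVolumeConst_pos (d : ℕ) : 0 < ballVolumeConst d := by
  have : 0 < volume.real (Metric.ball (0 : EuclideanSpace ℝ (Fin d)) 1) :=
    ENNReal.toReal_pos (Metric.measure_ball_pos _ _ one_pos).ne' measure_ball_lt_top.ne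
  unfold ballVolumeConst
  positivity

theorem euclideanHausdorffMeasure_le_of_antilipschitz {X Y : Type*} [MetricSpace X] [MetricSpace Y]
    [MeasurableSpace X] [BorelSpace X] [MeasurableSpace Y] [BorelSpace Y] {d : ℕ} {f : X → Y}
    {s : Set X} {K : NNReal} (h : AntilipschitzWith K (s.domRestrict f)) :
    Measure.euclideanHausdorffMeasure d s ≤
      (K : ℝ≥0∞) ^ d * Measure.euclideanHausdorffMeasure d (f '' s) := by
  have h1 := h.le_hausdorffMeasure_image (d := d) (by positivity) Set.univ
  rw [← isometry_subtype_coe.hausdorffMeasure_image (Or.inl (by positivity)), Set.image_univ,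
    Set.image_univ, Subtype.range_coe, Set.range_domRestrict, ENNReal.rpow_natCast] at h1
  simp only [Measure.euclideanHausdorffMeasure_def, Measure.smul_apply, ENNReal.smul_def,
    smul_eq_mul]
  rw [mul_left_comm]
  gcongr

theorem euclideanHausdorffMeasure_image_eq_zero {X Y : Type*} [MetricSpace X] [MetricSpace Y]
    [MeasurableSpace X] [BorelSpace X] [MeasurableSpace Y] [BorelSpace Y] {d : ℕ} {f : X → Y}
    {s : Set X} {K : NNReal} (h : LipschitzOnWith K f s)
    (hs : Measure.euclideanHausdorffMeasure d s = 0) :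
    Measure.euclideanHausdorffMeasure d (f '' s) = 0 := by
  simp only [Measure.euclideanHausdorffMeasure_def, Measure.smul_apply, ENNReal.smul_def,
    smul_eq_mul, mul_eq_zero] at hs ⊢
  refine Or.inr (le_antisymm ((h.hausdorffMeasure_image_le (d := d) (by positivity)).trans ?_)
    zero_le)
  rcases hs with hs | hs
  · exact absurd hs (by
      simpa using Measure.addHaarScalarFactor_volume_hausdorffMeasure_ne_zero d)
  · simp [hs]

/-- σ maps the ball of radius r/2 into the ball of radius r, and its inverse is 2-Lipschitz there.
Each of the two steps loses a factor 2ᵈ, whence the 4ᵈ in `ballVolumeConst`. -/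
theorem IsC2Submanifold.volume_ball_ge {m d : ℕ} (hdm : d ≤ m)
    {M : Set (EuclideanSpace ℝ (Fin m))} (hM : IsC2Submanifold d M) (h0 : 0 ∈ M) :
    ∃ r₀ : ℝ, 0 < r₀ ∧ ∀ r : ℝ, 0 < r → r ≤ r₀ →
      ENNReal.ofReal (ballVolumeConst d * r ^ d) ≤ submanifoldVolume d M (Metric.ball 0 r) := by
  obtain ⟨σ, J, δ, hδ, hσ0, happ, hσM, -⟩ := hM.exists_parametrization hdm h0
  refine ⟨δ, hδ, fun r hr hrδ => ?_⟩
  have hsub : Metric.ball 0 (r / 2) ⊆ Metric.closedBall (0 : EuclideanSpace ℝ (Fin d)) δ :=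
    (Metric.ball_subset_closedBall).trans (Metric.closedBall_subset_closedBall (by linarith))
  have himg : σ '' Metric.ball 0 (r / 2) ⊆ Metric.ball 0 r ∩ M := by
    rintro _ ⟨w, hw, rfl⟩
    have h := happ.norm_sub_le_of_isometry (hsub hw) (Metric.mem_closedBall_self hδ.le)
    rw [hσ0, sub_zero, sub_zero] at h
    rw [mem_ball_zero_iff] at hw
    exact ⟨mem_ball_zero_iff.2 (by linarith), hσM w (hsub (mem_ball_zero_iff.2 hw))⟩
  have hanti : AntilipschitzWith 2 ((Metric.ball (0 : EuclideanSpace ℝ (Fin d)) (r / 2)).domRestrict σ) :=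
    AntilipschitzWith.of_le_mul_dist fun x y => by
      rw [Subtype.dist_eq, dist_eq_norm, dist_eq_norm]
      exact happ.norm_sub_ge_of_isometry (hsub x.2) (hsub y.2)
  have h1 := euclideanHausdorffMeasure_le_of_antilipschitz (d := d) hanti
  rw [EuclideanSpace.euclideanHausdorffMeasure_eq_volume, Measure.addHaar_ball_of_pos _ _ (by positivity)]
    at h1
  have h2 : Measure.euclideanHausdorffMeasure d (σ '' Metric.ball 0 (r / 2)) ≤
      submanifoldVolume d M (Metric.ball 0 r) := by
    rw [submanifoldVolume, Measure.restrict_apply measurableSet_ball]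
    exact measure_mono himg
  have h3 := h1.trans (mul_le_mul_right h2 _)
  have h4 : ENNReal.ofReal (ballVolumeConst d * r ^ d) * ((2 : NNReal) : ℝ≥0∞) ^ d
      = ENNReal.ofReal ((r / 2) ^ Module.finrank ℝ (EuclideanSpace ℝ (Fin d))) *
        volume (Metric.ball (0 : EuclideanSpace ℝ (Fin d)) 1) := by
    rw [← ENNReal.ofReal_toReal
      (measure_ball_lt_top (μ := volume) (x := (0 : EuclideanSpace ℝ (Fin d))) (r := 1)).ne,
      ← ENNReal.ofReal_mul (by positivity), show ((2 : NNReal) : ℝ≥0∞) = ENNReal.ofReal 2 by simp,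
      ← ENNReal.ofReal_pow (by norm_num), ← ENNReal.ofReal_mul (by have := ballVolumeConst_pos d; positivity)]
    congr 1
    simp only [finrank_euclideanSpace, Fintype.card_fin, ballVolumeConst, Measure.real, div_pow]
    rw [show (4 : ℝ) = 2 * 2 by norm_num, mul_pow]
    field_simp
  rw [← h4, mul_comm] at h3
  exact (ENNReal.mul_le_mul_iff_right (by simp) (by simp)).1 h3

/-- The preimage of the sphere under σ meets each ray at most once away from 0, so it is Lebesgue
null, and Lipschitz images preserve null sets of Hausdorff measure. -/
theorem IsC2Submanifold.volume_sphere_eq_zero {m d : ℕ} (hd : 1 ≤ d) (hdm : d ≤ m)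
    {M : Set (EuclideanSpace ℝ (Fin m))} (hM : IsC2Submanifold d M) (h0 : 0 ∈ M) :
    ∃ r₀ : ℝ, 0 < r₀ ∧ ∀ s : ℝ, s < r₀ → submanifoldVolume d M (Metric.sphere 0 s) = 0 := by
  obtain ⟨σ, J, δ, hδ, hσ0, happ, hσM, η, hη, himg⟩ := hM.exists_parametrization hdm h0
  refine ⟨η, hη, fun s hs => ?_⟩
  have hlip : LipschitzOnWith (5 / 4) σ (Metric.closedBall 0 δ) :=
    LipschitzOnWith.of_dist_le_mul fun x hx y hy => by
      rw [dist_eq_norm, dist_eq_norm]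
      simpa using happ.norm_sub_le_of_isometry hx hy
  set S : Set (EuclideanSpace ℝ (Fin d)) := Metric.closedBall 0 δ ∩ σ ⁻¹' Metric.sphere 0 s with hS
  have hSclosed : IsClosed S :=
    hlip.continuousOn.preimage_isClosed_of_isClosed Metric.isClosed_closedBall Metric.isClosed_sphere
  have hvol : volume S = 0 := by
    -- Here d ≥ 1 matters: single points are then null, so the origin may be removed from S.
    have : Nonempty (Fin d) := ⟨⟨0, hd⟩⟩
    have h1 : volume (S \ {0}) = 0 := by
      refine addHaar_eq_zero_of_rays volume (hSclosed.measurableSet.diff (measurableSet_singleton 0))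
        (fun w hw => hw.1.1) fun w hw t ht htw => ?_
      have := happ.norm_lt_norm_smul (Metric.mem_closedBall_self hδ.le) hσ0 ht hw.2 hw.1.1 htw.1.1
      rw [mem_sphere_zero_iff_norm.1 hw.1.2, mem_sphere_zero_iff_norm.1 htw.1.2] at this
      exact lt_irrefl _ this
    exact (measure_sdiff_null (measure_singleton 0)).symm.trans h1
  rw [submanifoldVolume, Measure.restrict_apply Metric.isClosed_sphere.measurableSet]
  refine measure_mono_null (t := σ '' S) ?_ (euclideanHausdorffMeasure_image_eq_zero
    (hlip.mono Set.inter_subset_left) (by rwa [EuclideanSpace.euclideanHausdorffMeasure_eq_volume]))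
  rintro x ⟨hxs, hxM⟩
  obtain ⟨w, hw, rfl⟩ := himg ⟨hxM, mem_ball_zero_iff.2 ((mem_sphere_zero_iff_norm.1 hxs).trans_lt hs)⟩
  exact ⟨w, ⟨hw, hxs⟩, rfl⟩

/-! ### Almost sure bound: counting, Chernoff, Borel–Cantelli -/

theorem nnDist_le_of_lt_card {m n : ℕ} (x : Fin n → EuclideanSpace ℝ (Fin m)) {k : ℕ} (hk : k < n)
    {r : ℝ} (h : k < (Finset.univ.filter fun i => ‖x i‖ ≤ r).card) : nnDist x k hk ≤ r := by
  by_contra! hlt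
  -- If the distance at rank k (counted from 0) exceeded r, all points within r would have rank
  -- below k, so there would be at most k of them.
  have hsub : (Finset.univ.filter fun i => ‖x i‖ ≤ r) ⊆
      (Finset.Iio (⟨k, hk⟩ : Fin n)).image (nnOrder x) := by
    intro i hi
    rw [Finset.mem_filter] at hi
    refine Finset.mem_image.2 ⟨(nnOrder x).symm i, ?_, by simp⟩
    rw [Finset.mem_Iio]
    by_contra! hle
    have h1 := Tuple.monotone_sort (fun i => ‖x i‖) hle
    simp only [Function.comp_apply] at h1
    have h2 : Tuple.sort (fun i => ‖x i‖) ((nnOrder x).symm i) = i := (nnOrder x).apply_symm_apply i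
    rw [h2] at h1
    exact absurd (hlt.trans_le (h1.trans hi.2)) (lt_irrefl _)
  have := (Finset.card_le_card hsub).trans Finset.card_image_le
  rw [Fin.card_Iio] at this
  exact absurd (h.trans_le this) (lt_irrefl _)

/-- A Chernoff bound for the lower tail of the number of sample points in a set. -/
theorem measure_card_le_le_exp {ι Ω E : Type*} [Fintype ι] [MeasurableSpace Ω] [MeasurableSpace E]
    {μ : Measure Ω} [IsProbabilityMeasure μ] {P : Measure E} {X : ι → Ω → E}
    (hX : ∀ i, Measurable (X i)) (hind : iIndepFun X μ) (hlaw : ∀ i, μ.map (X i) = P)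
    {B : Set E} (hB : MeasurableSet B) [DecidablePred (· ∈ B)] (a : ℝ) :
    μ.real {ω | ((Finset.univ.filter fun i => X i ω ∈ B).card : ℝ) ≤ a} ≤
      Real.exp (a - Fintype.card ι * P.real B / 2) := by
  set f : E → ℝ := B.indicator fun _ => 1 with hf
  have hfm : Measurable f := measurable_const.indicator hB
  have hcard : ∀ ω, ((Finset.univ.filter fun i => X i ω ∈ B).card : ℝ) =
      (∑ i, f ∘ X i) ω := fun ω => by
    simp only [Finset.sum_apply, Function.comp_apply, hf, Set.indicator_apply]
    simp
  have hindf : iIndepFun (fun i => f ∘ X i) μ := hind.comp (fun _ => f) fun _ => hfm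
  -- An indicator takes only the values 0 and 1, so its exponential is affine in it and the moment
  -- generating function is explicit.
  have hexp : ∀ x, Real.exp (-1 * f x) = 1 - (1 - Real.exp (-1)) * f x := fun x => by
    by_cases hx : x ∈ B <;> simp [hf, hx]
  have hint : ∀ i, Integrable (f ∘ X i) μ := fun i =>
    Integrable.of_bound (C := 1) (hfm.comp (hX i)).aestronglyMeasurable (ae_of_all _ fun ω => by
      by_cases hx : X i ω ∈ B <;> simp [hf, hx])
  have hmgf : ∀ i, mgf (f ∘ X i) μ (-1) = 1 - (1 - Real.exp (-1)) * P.real B := fun i => by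
    have h1 : ∫ ω, (f ∘ X i) ω ∂μ = P.real B := by
      have h2 : ∫ ω, (f ∘ X i) ω ∂μ = ∫ x, f x ∂P := by
        rw [← hlaw i, integral_map (hX i).aemeasurable hfm.aestronglyMeasurable]; rfl
      rw [h2, hf, integral_indicator hB]
      simp
    simp only [mgf, Function.comp_apply, hexp]
    have h3 : Integrable (fun ω => f (X i ω)) μ := hint i
    rw [integral_sub (integrable_const _) (h3.const_mul _), integral_const_mul]
    simp only [integral_const, probReal_univ, smul_eq_mul, mul_one]
    rw [← h1]; rfl
  have hsum_meas : Measurable (∑ i, f ∘ X i) := by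
    have : (∑ i, f ∘ X i) = fun ω => ∑ i, f (X i ω) := by ext; simp
    rw [this]
    exact Finset.measurable_sum _ fun i _ => hfm.comp (hX i)
  have hsum_nonneg : ∀ ω, 0 ≤ (∑ i, f ∘ X i) ω := fun ω => by
    rw [← hcard]; positivity
  have hch := measure_le_le_exp_mul_mgf (μ := μ) (X := ∑ i, f ∘ X i) (t := -1) a (by norm_num)
    (Integrable.of_bound (C := 1) (by fun_prop) (ae_of_all _ fun ω => by
      rw [Real.norm_of_nonneg (Real.exp_nonneg _), Real.exp_le_one_iff]
      linarith [hsum_nonneg ω]))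
  rw [hindf.mgf_sum (fun i => hfm.comp (hX i))] at hch
  simp only [hcard]
  refine hch.trans ?_
  have hp : 0 ≤ P.real B := measureReal_nonneg
  have he : Real.exp (-1) ≤ 1 / 2 := by
    rw [Real.exp_neg, inv_le_comm₀ (Real.exp_pos _) (by norm_num)]
    have := Real.add_one_le_exp (1 : ℝ)
    norm_num at this ⊢
    exact this
  calc Real.exp (- -1 * a) * ∏ i, mgf (f ∘ X i) μ (-1)
      ≤ Real.exp a * ∏ _i : ι, Real.exp (-(P.real B / 2)) := by
        rw [neg_neg, one_mul]
        refine mul_le_mul_of_nonneg_left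
          (Finset.prod_le_prod (fun i _ => mgf_nonneg) fun i _ => ?_) (Real.exp_nonneg _)
        rw [hmgf]
        -- With e⁻¹ ≤ 1/2 and p = P(B): 1 - (1 - e⁻¹) p ≤ 1 - p/2 ≤ exp(-p/2).
        have := Real.one_sub_le_exp_neg (P.real B / 2)
        nlinarith
    _ = _ := by
        rw [Finset.prod_const, ← Real.exp_nat_mul, ← Real.exp_add, Finset.card_univ]
        congr 1; ring

theorem tendsto_log_div_natCast : Tendsto (fun n : ℕ => Real.log n / n) atTop (𝓝 0) :=
  Real.isLittleO_log_id_atTop.tendsto_div_nhds_zero.comp tendsto_natCast_atTop_atTop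

/-- If the law of the sample gives mass at least `c * r ^ d` to the small balls of radius `r`, then
almost surely the `C log n` nearest neighbours are eventually within distance of order
`(log n / n) ^ (1 / d)`. -/
theorem ae_eventually_nnDist_le {m d : ℕ} (hd : 1 ≤ d) {P : Measure (EuclideanSpace ℝ (Fin m))}
    [IsProbabilityMeasure P] {c r₀ : ℝ} (hc : 0 < c) (hr₀ : 0 < r₀)
    (hP : ∀ r : ℝ, 0 < r → r ≤ r₀ → ENNReal.ofReal (c * r ^ d) ≤ P (Metric.ball 0 r))
    {Ω : Type*} [MeasurableSpace Ω] {μ : Measure Ω} [IsProbabilityMeasure μ]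
    {X : ℕ → Ω → EuclideanSpace ℝ (Fin m)} (hX : ∀ i, Measurable (X i)) (hind : iIndepFun X μ)
    (hlaw : ∀ i, μ.map (X i) = P) {C : ℝ} (hC : 1 ≤ C) :
    ∀ᵐ ω ∂μ, ∀ᶠ n : ℕ in atTop, ∃ hk : ⌈C * Real.log (n : ℝ)⌉₊ < n,
      nnDist (fun i : Fin n => X i ω) ⌈C * Real.log (n : ℝ)⌉₊ hk ≤
        (6 * C / c * (Real.log n / n)) ^ ((1 : ℝ) / d) := by
  classical
  set r : ℕ → ℝ := fun n => (6 * C / c * (Real.log n / n)) ^ ((1 : ℝ) / d) with hr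
  have hd0 : (0 : ℝ) < 1 / d := by positivity
  have hrlim : Tendsto r atTop (𝓝 0) := by
    have h1 : Tendsto (fun n : ℕ => 6 * C / c * (Real.log n / n)) atTop (𝓝 0) := by
      simpa using tendsto_log_div_natCast.const_mul (6 * C / c)
    have := h1.rpow_const (p := (1 : ℝ) / d) (Or.inr hd0.le)
    rwa [Real.zero_rpow hd0.ne'] at this
  have hkn : ∀ᶠ n : ℕ in atTop, ⌈C * Real.log (n : ℝ)⌉₊ < n := by
    have h1 := (tendsto_log_div_natCast.const_mul C).eventually_lt_const
      (show C * 0 < 1 / 2 by norm_num)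
    filter_upwards [h1, eventually_ge_atTop 3] with n hn hn3
    have hn0 : (3 : ℝ) ≤ n := by exact_mod_cast hn3
    have hlog : 0 ≤ Real.log n := Real.log_nonneg (by linarith)
    have h2 := Nat.ceil_lt_add_one (show 0 ≤ C * Real.log n by positivity)
    rw [← mul_div_assoc, div_lt_iff₀ (by linarith)] at hn
    have : ((⌈C * Real.log (n : ℝ)⌉₊ : ℕ) : ℝ) < n := by linarith
    exact_mod_cast this
  obtain ⟨n₁, hn₁⟩ := eventually_atTop.1
    ((hkn.and (hrlim.eventually_le_const hr₀)).and (eventually_ge_atTop 2))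
  -- Requiring `n₁ ≤ n` makes the early events empty, so that one summable bound holds for every n.
  set bad : ℕ → Set Ω := fun n => {ω | n₁ ≤ n ∧
    ((Finset.univ.filter fun i : Fin n => X i ω ∈ Metric.ball 0 (r n)).card : ℝ) ≤
      ⌈C * Real.log (n : ℝ)⌉₊} with hbad
  have hbound : ∀ n, μ (bad n) ≤ ENNReal.ofReal (Real.exp 1 * (1 / (n : ℝ) ^ 2)) := by
    intro n
    by_cases hn : n₁ ≤ n
    swap
    · simp [hbad, hn]
    obtain ⟨⟨-, hrn⟩, hn2⟩ := hn₁ n hn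
    have hn2' : (2 : ℝ) ≤ n := by exact_mod_cast hn2
    have hlog : 0 < Real.log n := Real.log_pos (by linarith)
    have hr0 : 0 < r n := by simp only [hr]; positivity
    -- The Chernoff exponent subtracts half of this, 3 C log n. Since ⌈C log n⌉ < C log n + 1, it is
    -- at most 1 - 2 C log n ≤ 1 - 2 log n because C ≥ 1, which gives the summable bound e/n².
    have hmass : 6 * C * Real.log n ≤ n * P.real (Metric.ball 0 (r n)) := by
      have h1 := (ENNReal.ofReal_le_iff_le_toReal (measure_ne_top _ _)).1 (hP _ hr0 hrn)
      have h2 : r n ^ d = 6 * C / c * (Real.log n / n) := by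
        simp only [hr]
        rw [← Real.rpow_natCast, ← Real.rpow_mul (by positivity),
          one_div_mul_cancel (by positivity), Real.rpow_one]
      rw [h2] at h1
      have h3 : c * (6 * C / c * (Real.log n / n)) = 6 * C * Real.log n / n := by field_simp
      rw [h3, div_le_iff₀ (by positivity)] at h1
      rw [mul_comm (n : ℝ)]
      exact h1
    have h1 := measure_card_le_le_exp (μ := μ) (P := P) (X := fun i : Fin n => X i)
      (fun i => hX i) (hind.precomp Fin.val_injective) (fun i => hlaw i)
      (B := Metric.ball 0 (r n)) measurableSet_ball ⌈C * Real.log (n : ℝ)⌉₊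
    have h2 : bad n = {ω | ((Finset.univ.filter fun i : Fin n => X i ω ∈
        Metric.ball 0 (r n)).card : ℝ) ≤ ⌈C * Real.log (n : ℝ)⌉₊} := by simp [hbad, hn]
    rw [h2]
    refine (ENNReal.le_ofReal_iff_toReal_le (measure_ne_top _ _) (by positivity)).2 (h1.trans ?_)
    have h3 := Nat.ceil_lt_add_one (show 0 ≤ C * Real.log n by positivity)
    rw [one_div, ← Real.exp_log (show (0 : ℝ) < ((n : ℝ) ^ 2)⁻¹ by positivity), ← Real.exp_add,
      Real.log_inv, Real.log_pow]
    refine Real.exp_le_exp.2 ?_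
    rw [Fintype.card_fin]
    push_cast
    nlinarith
  have hsum : ∑' n, μ (bad n) ≠ ∞ := by
    refine ne_top_of_le_ne_top ?_ (ENNReal.tsum_le_tsum hbound)
    exact ((Real.summable_one_div_nat_pow.2 one_lt_two).mul_left _).tsum_ofReal_ne_top
  filter_upwards [ae_eventually_notMem hsum] with ω hω
  filter_upwards [hω, eventually_ge_atTop n₁] with n hn hn1
  refine ⟨(hn₁ n hn1).1.1, nnDist_le_of_lt_card _ _ ?_⟩
  simp only [hbad, Set.mem_ofPred_eq, not_and, not_le, Nat.cast_lt] at hn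
  refine (hn hn1).trans_le (Finset.card_le_card ?_)
  intro i hi
  simp only [Finset.mem_filter, mem_ball_zero_iff, Finset.mem_univ, true_and] at hi ⊢
  exact hi.le

/-! ### The ordering of the sample: strict neighbors and measurability -/

section Order

variable {m n : ℕ}

theorem norm_nnOrder_monotone (x : Fin n → EuclideanSpace ℝ (Fin m)) :
    Monotone fun l => ‖x (nnOrder x l)‖ :=
  Tuple.monotone_sort fun i => ‖x i‖

theorem mem_nnIndices_iff (x : Fin n → EuclideanSpace ℝ (Fin m)) {k : ℕ} (hk : k < n) (i : Fin n) :
    i ∈ nnIndices x k hk ↔ (nnOrder x).symm i < ⟨k, hk⟩ := by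
  simp only [nnIndices, Finset.mem_map, Finset.mem_univ, true_and, Function.Embedding.trans_apply,
    Fin.castLEEmb_apply, Equiv.coe_toEmbedding]
  constructor
  · rintro ⟨l, rfl⟩
    rw [Equiv.symm_apply_apply]
    exact l.2
  · intro h
    exact ⟨⟨(nnOrder x).symm i, h⟩, (nnOrder x).apply_symm_apply i⟩

/-- `j` is the strict `(k + 1)`-st nearest neighbour of the origin and `S` the set of the nearer
sample points. -/
def StrictNeighbor (x : Fin n → EuclideanSpace ℝ (Fin m)) (j : Fin n) (S : Finset (Fin n)) :
    Prop :=
  (∀ i ∈ S, ‖x i‖ < ‖x j‖) ∧ ∀ i, i ≠ j → i ∉ S → ‖x j‖ < ‖x i‖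

/-- Strict inequalities force any sorting to place exactly S before j, whatever the tie-breaking, so
the rank of j is the cardinality of S. -/
theorem StrictNeighbor.nnOrder_eq {x : Fin n → EuclideanSpace ℝ (Fin m)} {j : Fin n}
    {S : Finset (Fin n)} (h : StrictNeighbor x j S) {k : ℕ} (hk : k < n) (hS : S.card = k) :
    nnOrder x ⟨k, hk⟩ = j ∧ nnIndices x k hk = S := by
  set p := (nnOrder x).symm j with hp
  have hpj : nnOrder x p = j := (nnOrder x).apply_symm_apply j
  have hmem : ∀ i, i ∈ S ↔ (nnOrder x).symm i < p := by
    intro i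
    have hi : nnOrder x ((nnOrder x).symm i) = i := (nnOrder x).apply_symm_apply i
    constructor
    · intro hiS
      by_contra! hle
      have := norm_nnOrder_monotone x hle
      simp only [hi, hpj] at this
      exact absurd (h.1 i hiS) (not_lt.2 this)
    · intro hlt
      by_contra hiS
      have hne : i ≠ j := by rintro rfl; exact lt_irrefl _ hlt
      have := norm_nnOrder_monotone x hlt.le
      simp only [hi, hpj] at this
      exact absurd (h.2 i hne hiS) (not_lt.2 this)
  have hSmap : S = (Finset.Iio p).map (nnOrder x).toEmbedding := by
    ext i
    rw [hmem, Finset.mem_map_equiv, Finset.mem_Iio]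
  have hpk : p = ⟨k, hk⟩ := by
    have hc : (p : ℕ) = S.card := by rw [hSmap, Finset.card_map, Fin.card_Iio]
    exact Fin.ext (hc.trans hS)
  refine ⟨hpk ▸ hpj, ?_⟩
  ext i
  rw [mem_nnIndices_iff, hmem, hpk]

/-- Sorting gives weak inequalities; only a tie at the critical distance could prevent them from
being strict. Ties elsewhere are harmless. -/
theorem strictNeighbor_of_forall_ne (x : Fin n → EuclideanSpace ℝ (Fin m)) {k : ℕ} (hk : k < n)
    (h : ∀ i, i ≠ nnOrder x ⟨k, hk⟩ → ‖x i‖ ≠ ‖x (nnOrder x ⟨k, hk⟩)‖) :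
    StrictNeighbor x (nnOrder x ⟨k, hk⟩) (nnIndices x k hk) := by
  refine ⟨fun i hi => ?_, fun i hij hi => ?_⟩
  · rw [mem_nnIndices_iff] at hi
    have h1 := norm_nnOrder_monotone x hi.le
    simp only [Equiv.apply_symm_apply] at h1
    refine lt_of_le_of_ne h1 (h i ?_)
    rintro rfl
    simp at hi
  · rw [mem_nnIndices_iff, not_lt] at hi
    have h1 := norm_nnOrder_monotone x hi
    simp only [Equiv.apply_symm_apply] at h1
    exact lt_of_le_of_ne h1 (h i hij).symm

theorem nnOrder_notMem_nnIndices (x : Fin n → EuclideanSpace ℝ (Fin m)) {k : ℕ} (hk : k < n) :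
    nnOrder x ⟨k, hk⟩ ∉ nnIndices x k hk := by
  simp [mem_nnIndices_iff]

theorem nearestNeighbors_eq {x : Fin n → EuclideanSpace ℝ (Fin m)} {k : ℕ} (hk : k < n)
    {S : Finset (Fin n)} (hS : S.card = k) (h : nnIndices x k hk = S) :
    nearestNeighbors x k hk = fun l => x (S.orderEmbOfFin hS l) := by
  subst h
  rfl

theorem measurableSet_nnOrder_eq (τ : Equiv.Perm (Fin n)) :
    MeasurableSet {x : Fin n → EuclideanSpace ℝ (Fin m) | nnOrder x = τ} := by
  have h : ∀ x : Fin n → EuclideanSpace ℝ (Fin m), nnOrder x = τ ↔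
      (∀ i j, i ≤ j → ‖x (τ i)‖ ≤ ‖x (τ j)‖) ∧
        ∀ i j, i < j → ‖x (τ i)‖ = ‖x (τ j)‖ → τ i < τ j := fun x => by
    rw [eq_comm, nnOrder, Tuple.eq_sort_iff]; rfl
  simp only [h]
  have hm : ∀ i : Fin n, Measurable fun x : Fin n → EuclideanSpace ℝ (Fin m) => ‖x i‖ :=
    fun i => (measurable_pi_apply i).norm
  simp only [Set.ofPred_and, Set.ofPred_forall]
  refine MeasurableSet.inter ?_ ?_
  · exact MeasurableSet.iInter fun i => MeasurableSet.iInter fun j => MeasurableSet.iInter fun _ =>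
      measurableSet_le (hm _) (hm _)
  · refine MeasurableSet.iInter fun i => MeasurableSet.iInter fun j => MeasurableSet.iInter fun _ =>
      ?_
    by_cases hτ : τ i < τ j
    · simp [hτ]
    · simp only [hτ, imp_false]
      exact (measurableSet_eq_fun (hm _) (hm _)).compl

/-- There are finitely many permutations and each is selected on a measurable set, so functions of
the ordered sample are measurable piece by piece. -/
theorem measurable_nnOrder_apply {β : Type*} [MeasurableSpace β]
    {F : Equiv.Perm (Fin n) → (Fin n → EuclideanSpace ℝ (Fin m)) → β} (hF : ∀ τ, Measurable (F τ)) :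
    Measurable fun x => F (nnOrder x) x := by
  intro s hs
  have : (fun x => F (nnOrder x) x) ⁻¹' s = ⋃ τ, {x | nnOrder x = τ} ∩ F τ ⁻¹' s := by
    ext x
    simp
  rw [this]
  exact MeasurableSet.iUnion fun τ => (measurableSet_nnOrder_eq τ).inter (hF τ hs)

theorem measurable_nnDist {k : ℕ} (hk : k < n) :
    Measurable fun x : Fin n → EuclideanSpace ℝ (Fin m) => nnDist x k hk :=
  measurable_nnOrder_apply (F := fun τ x => ‖x (τ ⟨k, hk⟩)‖) fun _ => (measurable_pi_apply _).norm

theorem measurable_nearestNeighbors {k : ℕ} (hk : k < n) :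
    Measurable fun x : Fin n → EuclideanSpace ℝ (Fin m) => nearestNeighbors x k hk := by
  refine measurable_nnOrder_apply (F := fun τ x i => x (Finset.orderEmbOfFin
    (Finset.univ.map ((Fin.castLEEmb hk.le).trans τ.toEmbedding)) (k := k) (by simp) i)) fun _ => ?_
  exact measurable_pi_lambda _ fun i => measurable_pi_apply _

end Order

/-! ### Fubini with one frozen coordinate, and the conditional laws on balls -/

/-- Fubini's theorem for an i.i.d. sample, with one coordinate singled out. -/
theorem lintegral_pi_mul_prod_succAbove {E : Type*} [MeasurableSpace E] (P : Measure E)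
    [IsProbabilityMeasure P] {n : ℕ} (j : Fin (n + 1)) {h : E → ℝ≥0∞} (hh : Measurable h)
    {φ : Fin n → E → E → ℝ≥0∞} (hφ : ∀ i, Measurable (Function.uncurry (φ i))) :
    ∫⁻ x, h (x j) * ∏ i, φ i (x j) (x (j.succAbove i)) ∂(Measure.pi fun _ : Fin (n + 1) => P) =
      ∫⁻ y, h y * ∏ i, ∫⁻ z, φ i y z ∂P ∂P := by
  have hmp := measurePreserving_piFinSuccAbove (fun _ : Fin (n + 1) => P) j
  set F : E × (Fin n → E) → ℝ≥0∞ := fun p => h p.1 * ∏ i, φ i p.1 (p.2 i) with hF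
  have hFm : Measurable F := by
    refine (hh.comp measurable_fst).mul (Finset.measurable_prod _ fun i _ => ?_)
    exact (hφ i).comp (measurable_fst.prodMk ((measurable_pi_apply i).comp measurable_snd))
  have h1 := hmp.lintegral_comp hFm
  refine Eq.trans ?_ (h1.trans ?_)
  · rfl
  · rw [lintegral_prod _ hFm.aemeasurable]
    refine lintegral_congr fun y => ?_
    have hm : ∀ i, Measurable (φ i y) := fun i => (hφ i).comp measurable_prodMk_left
    simp only [hF]
    have hm' : Measurable fun x : Fin n → E => ∏ i, φ i y (x i) :=
      Finset.measurable_prod _ fun i _ => (hm i).comp (measurable_pi_apply i)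
    rw [lintegral_const_mul _ hm']
    congr 1
    rw [lintegral_prod_eq_prod_lintegral_of_indepFun _ (fun i (x : Fin n → E) => φ i y (x i))
      (iIndepFun_pi (X := fun i => φ i y) fun i => (hm i).aemeasurable)
      fun i => (hm i).comp (measurable_pi_apply i)]
    refine Finset.prod_congr rfl fun i _ => ?_
    exact (measurePreserving_eval (fun _ : Fin n => P) i).lintegral_comp (hm i)

section BallLaw

variable {E : Type*} [NormedAddCommGroup E] [MeasurableSpace E] (P : Measure E)

/-- Monotonicity in the radius suffices, so A may be an arbitrary set. -/
theorem measurable_measure_ball_inter (A : Set E) :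
    Measurable fun s : ℝ => P (Metric.ball 0 s ∩ A) := by
  refine Monotone.measurable fun s t hst => measure_mono ?_
  exact Set.inter_subset_inter_left _ (Metric.ball_subset_ball hst)

theorem measurable_measure_ball : Measurable fun s : ℝ => P (Metric.ball 0 s) := by
  simpa using measurable_measure_ball_inter P Set.univ

variable [OpensMeasurableSpace E]

theorem measurable_cond_ball (A : Set E) :
    Measurable fun s : ℝ => (P[|Metric.ball 0 s]) A := by
  simp only [cond_apply measurableSet_ball]
  exact (measurable_measure_ball P).inv.mul (measurable_measure_ball_inter P A)

theorem measurableSet_measure_sphere_eq_zero [IsFiniteMeasure P] :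
    MeasurableSet {s : ℝ | P (Metric.sphere 0 s) = 0} := by
  have hc : Measurable fun s : ℝ => P (Metric.closedBall 0 s) :=
    Monotone.measurable fun s t hst => measure_mono (Metric.closedBall_subset_closedBall hst)
  -- For a finite measure the sphere is null exactly when closed and open ball have equal mass, and
  -- both masses are monotone in s.
  have : {s : ℝ | P (Metric.sphere 0 s) = 0} =
      {s : ℝ | P (Metric.closedBall 0 s) = P (Metric.ball 0 s)} := by
    ext s
    have h := measure_union (μ := P) (Metric.sphere_disjoint_ball (x := (0 : E)) (ε := s)).symm
      Metric.isClosed_sphere.measurableSet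
    rw [Metric.ball_union_sphere] at h
    simp only [Set.mem_ofPred_eq]
    rw [h]
    constructor
    · intro h0; rw [h0, add_zero]
    · intro h0
      exact (ENNReal.add_right_inj (measure_ne_top P (Metric.ball 0 s))).1 (h0.trans (add_zero _).symm)
  rw [this]
  exact measurableSet_eq_fun hc (measurable_measure_ball P)

open Classical in
/-- The conditional law of `P` on the open ball of radius `s` around the origin, replaced by `P`
itself if this ball is `P`-null. -/
noncomputable def ballLaw (s : ℝ) : Measure E :=
  if P (Metric.ball 0 s) = 0 then P else P[|Metric.ball 0 s]

instance isProbabilityMeasure_ballLaw [IsProbabilityMeasure P] (s : ℝ) :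
    IsProbabilityMeasure (ballLaw P s) := by
  unfold ballLaw
  split_ifs with h
  · infer_instance
  · exact cond_isProbabilityMeasure h

omit [OpensMeasurableSpace E] in
theorem ballLaw_of_ne_zero {s : ℝ} (h : P (Metric.ball 0 s) ≠ 0) :
    ballLaw P s = P[|Metric.ball 0 s] := if_neg h

theorem measurable_ballLaw_apply (A : Set E) : Measurable fun s => ballLaw P s A := by
  have : (fun s => ballLaw P s A) =
      fun s => if P (Metric.ball 0 s) = 0 then P A else (P[|Metric.ball 0 s]) A := by
    ext s
    unfold ballLaw
    split_ifs <;> rfl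
  rw [this]
  exact Measurable.ite (measurable_measure_ball P (measurableSet_singleton 0)) measurable_const
    (measurable_cond_ball P A)

/-- The Markov kernel sending `s` to the law of `k` independent points drawn from the conditional
law of `P` on the open ball of radius `s`. -/
noncomputable def ballSampleKernel [IsProbabilityMeasure P] (k : ℕ) : Kernel ℝ (Fin k → E) where
  toFun s := Measure.pi fun _ => ballLaw P s
  measurable' := by
    -- Checking boxes is enough for probability measures; the fallback value in `ballLaw` ensures
    -- this for every s.
    refine Measurable.measure_of_isPiSystem_of_isProbabilityMeasure generateFrom_pi.symm
      isPiSystem_pi ?_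
    rintro _ ⟨A, -, rfl⟩
    simp only [Measure.pi_pi]
    exact Finset.measurable_prod _ fun i _ => measurable_ballLaw_apply P _

theorem ballSampleKernel_apply [IsProbabilityMeasure P] (k : ℕ) (s : ℝ) :
    ballSampleKernel P k s = Measure.pi fun _ => ballLaw P s := rfl

instance isMarkovKernel_ballSampleKernel [IsProbabilityMeasure P] (k : ℕ) :
    IsMarkovKernel (ballSampleKernel P k) :=
  ⟨fun s => by rw [ballSampleKernel_apply]; infer_instance⟩

end BallLaw

/-! ### Conditional distribution of the nearest neighbors -/

section Sample

variable {m : ℕ} (P : Measure (EuclideanSpace ℝ (Fin m))) [IsProbabilityMeasure P]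

theorem measurableSet_strictNeighbor {n : ℕ} (j : Fin n) (S : Finset (Fin n)) {B : Set ℝ}
    (hB : MeasurableSet B) :
    MeasurableSet {x : Fin n → EuclideanSpace ℝ (Fin m) | StrictNeighbor x j S ∧ ‖x j‖ ∈ B} := by
  have hm : ∀ i : Fin n, Measurable fun x : Fin n → EuclideanSpace ℝ (Fin m) => ‖x i‖ :=
    fun i => (measurable_pi_apply i).norm
  simp only [StrictNeighbor, Set.ofPred_and, Set.ofPred_forall]
  refine (MeasurableSet.inter ?_ ?_).inter (hm j hB)
  · exact MeasurableSet.iInter fun i => MeasurableSet.iInter fun _ => measurableSet_lt (hm _) (hm _)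
  · exact MeasurableSet.iInter fun i => MeasurableSet.iInter fun _ => MeasurableSet.iInter fun _ =>
      measurableSet_lt (hm _) (hm _)

theorem strictNeighbor_iff_succAbove {n : ℕ} {x : Fin (n + 1) → EuclideanSpace ℝ (Fin m)}
    {j : Fin (n + 1)} {S : Finset (Fin (n + 1))} (hj : j ∉ S) :
    StrictNeighbor x j S ↔ ∀ i, if j.succAbove i ∈ S then ‖x (j.succAbove i)‖ < ‖x j‖ else
      ‖x j‖ < ‖x (j.succAbove i)‖ := by
  constructor
  · intro h i
    split_ifs with hi
    · exact h.1 _ hi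
    · exact h.2 _ (Fin.succAbove_ne _ _) hi
  · intro h
    refine ⟨fun i hi => ?_, fun i hij hi => ?_⟩
    · obtain ⟨i, rfl⟩ := Fin.exists_succAbove_eq (show i ≠ j by rintro rfl; exact hj hi)
      have := h i
      rwa [if_pos hi] at this
    · obtain ⟨i, rfl⟩ := Fin.exists_succAbove_eq hij
      have := h i
      rwa [if_neg hi] at this

theorem lintegral_ite_one {E : Type*} [MeasurableSpace E] (P : Measure E) {p : E → Prop}
    {_ : DecidablePred p} (hp : MeasurableSet {z | p z}) :
    ∫⁻ z, (if p z then (1 : ℝ≥0∞) else 0) ∂P = P {z | p z} := by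
  rw [← lintegral_indicator_one hp]
  refine lintegral_congr fun z => ?_
  simp [Set.indicator_apply]

theorem ite_eq_mul {p q b : Prop} {_ : Decidable (p ∧ b)} {_ : Decidable q} {_ : Decidable b}
    (h : p ↔ q) (c : ℝ≥0∞) :
    (if p ∧ b then c else 0) = (if b then c else 0) * (if q then 1 else 0) := by
  by_cases hq : q <;> by_cases hb : b <;> simp [h, hq, hb]

open Classical in
/-- Given that `j` is the strict `(k + 1)`-st nearest neighbour and `S` the set of the indices of
the `k` nearest ones, the sample points in `S` are distributed like an i.i.d. sample from the
conditional law on the ball of radius `‖x j‖`. -/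
theorem setLIntegral_strictNeighbor {n k : ℕ} (j : Fin (n + 1)) (S : Finset (Fin (n + 1)))
    (hS : S.card = k) (hj : j ∉ S) {B : Set ℝ} (hB : MeasurableSet B)
    (hB0 : ∀ t ∈ B, P (Metric.ball 0 t) ≠ 0) {A : Fin k → Set (EuclideanSpace ℝ (Fin m))}
    (hA : ∀ l, MeasurableSet (A l)) :
    ∫⁻ x in {x | StrictNeighbor x j S ∧ ‖x j‖ ∈ B},
        (if ∀ l, x (S.orderEmbOfFin hS l) ∈ A l then 1 else 0) ∂(Measure.pi fun _ => P) =
      ∫⁻ x in {x | StrictNeighbor x j S ∧ ‖x j‖ ∈ B},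
        ∏ l, ballLaw P ‖x j‖ (A l) ∂(Measure.pi fun _ => P) := by
  set e := S.orderEmbOfFin hS with he
  have hej : ¬ ∃ l, e l = j := by
    rintro ⟨l, hl⟩
    exact hj (hl ▸ S.orderEmbOfFin_mem hS l)
  have heS : ∀ i, i ∈ S ↔ ∃ l, e l = i := fun i => by
    rw [← Finset.mem_coe, ← S.range_orderEmbOfFin hS]; rfl
  -- Indices outside S receive the trivial constraint, so that both conditions become products over
  -- all indices other than j.
  set A' : Fin (n + 1) → Set (EuclideanSpace ℝ (Fin m)) :=
    Function.extend e A fun _ => Set.univ with hA'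
  have hA'm : ∀ i, MeasurableSet (A' i) := fun i => by
    by_cases hi : ∃ l, e l = i
    · obtain ⟨l, rfl⟩ := hi
      rw [hA', e.injective.extend_apply]; exact hA l
    · rw [hA', Function.extend_apply' _ _ _ hi]; exact MeasurableSet.univ
  have hAiff : ∀ x : Fin (n + 1) → EuclideanSpace ℝ (Fin m),
      (∀ l, x (e l) ∈ A l) ↔ ∀ i, x (j.succAbove i) ∈ A' (j.succAbove i) := by
    intro x
    have h1 : (∀ l, x (e l) ∈ A l) ↔ ∀ i, x i ∈ A' i := by
      constructor
      · intro h i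
        by_cases hi : ∃ l, e l = i
        · obtain ⟨l, rfl⟩ := hi
          rw [hA', e.injective.extend_apply]; exact h l
        · rw [hA', Function.extend_apply' _ _ _ hi]; exact Set.mem_univ _
      · intro h l
        have := h (e l)
        rwa [hA', e.injective.extend_apply] at this
    rw [h1, Fin.forall_iff_succAbove j]
    simp [hA', Function.extend_apply' _ _ _ hej]
  set D : Fin (n + 1) → Set (EuclideanSpace ℝ (Fin m) × EuclideanSpace ℝ (Fin m)) :=
    fun i => {p | if i ∈ S then ‖p.2‖ < ‖p.1‖ else ‖p.1‖ < ‖p.2‖} with hD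
  have hDm : ∀ i, MeasurableSet (D i) := fun i => by
    by_cases hi : i ∈ S
    · simp only [hD, hi, if_true]; exact measurableSet_lt measurable_snd.norm measurable_fst.norm
    · simp only [hD, hi, if_false]; exact measurableSet_lt measurable_fst.norm measurable_snd.norm
  have hTm := measurableSet_strictNeighbor (m := m) j S hB
  have hBm : MeasurableSet {y : EuclideanSpace ℝ (Fin m) | ‖y‖ ∈ B} := measurable_norm hB
  rw [← lintegral_indicator hTm, ← lintegral_indicator hTm]
  have hL := lintegral_pi_mul_prod_succAbove P j (h := fun y => if ‖y‖ ∈ B then 1 else 0)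
    (φ := fun i y z => if (y, z) ∈ D (j.succAbove i) ∧ z ∈ A' (j.succAbove i) then 1 else 0)
    (Measurable.ite hBm measurable_const measurable_const)
    (fun i => Measurable.ite ((hDm _).inter (measurable_snd (hA'm _))) measurable_const
      measurable_const)
  have hR := lintegral_pi_mul_prod_succAbove P j
    (h := fun y => if ‖y‖ ∈ B then ∏ l, ballLaw P ‖y‖ (A l) else 0)
    (φ := fun i y z => if (y, z) ∈ D (j.succAbove i) then 1 else 0)
    (Measurable.ite hBm (Finset.measurable_prod _ fun l _ =>
      (measurable_ballLaw_apply P (A l)).comp measurable_norm) measurable_const)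
    (fun i => Measurable.ite (hDm _) measurable_const measurable_const)
  have hL' : ∀ x : Fin (n + 1) → EuclideanSpace ℝ (Fin m),
      {x | StrictNeighbor x j S ∧ ‖x j‖ ∈ B}.indicator
        (fun x => if ∀ l, x (e l) ∈ A l then (1 : ℝ≥0∞) else 0) x =
      (if ‖x j‖ ∈ B then 1 else 0) * ∏ i, if (x j, x (j.succAbove i)) ∈ D (j.succAbove i) ∧
        x (j.succAbove i) ∈ A' (j.succAbove i) then (1 : ℝ≥0∞) else 0 := by
    intro x
    rw [Fintype.prod_ite_zero, Set.indicator_apply, Finset.prod_const_one]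
    rw [← ite_and]
    have hU : (StrictNeighbor x j S ∧ ∀ l, x (e l) ∈ A l) ↔
        ∀ i, (x j, x (j.succAbove i)) ∈ D (j.succAbove i) ∧
          x (j.succAbove i) ∈ A' (j.succAbove i) :=
      ((strictNeighbor_iff_succAbove hj).and (hAiff x)).trans forall_and.symm
    rw [← ite_eq_mul hU]
    refine if_congr ?_ rfl rfl
    rw [and_right_comm]; rfl
  have hR' : ∀ x : Fin (n + 1) → EuclideanSpace ℝ (Fin m),
      {x | StrictNeighbor x j S ∧ ‖x j‖ ∈ B}.indicator
        (fun x => ∏ l, ballLaw P ‖x j‖ (A l)) x =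
      (if ‖x j‖ ∈ B then ∏ l, ballLaw P ‖x j‖ (A l) else 0) *
        ∏ i, if (x j, x (j.succAbove i)) ∈ D (j.succAbove i) then (1 : ℝ≥0∞) else 0 := by
    intro x
    rw [Fintype.prod_ite_zero, Set.indicator_apply, Finset.prod_const_one]
    have hU : StrictNeighbor x j S ↔ ∀ i, (x j, x (j.succAbove i)) ∈ D (j.succAbove i) :=
      strictNeighbor_iff_succAbove hj
    exact ite_eq_mul hU _
  -- Both sides are now Fubini integrals over y = x_j, and it remains to compare the products of
  -- one-coordinate integrals.
  simp only [hL', hR']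
  rw [hL, hR]
  refine lintegral_congr fun y => ?_
  by_cases hy : ‖y‖ ∈ B
  swap
  · simp [hy]
  simp only [hy, if_true, one_mul]
  have hball := hB0 _ hy
  set q : Fin (n + 1) → ℝ≥0∞ := Function.extend e (fun l => ballLaw P ‖y‖ (A l)) 1 with hq
  have hprod : ∏ i, q (j.succAbove i) = ∏ l, ballLaw P ‖y‖ (A l) := by
    have h1 := Fin.prod_univ_succAbove q j
    rw [show q j = 1 by rw [hq, Function.extend_apply' _ _ _ hej]; rfl, one_mul] at h1
    rw [← h1]
    have h2 : ∏ i ∈ Finset.univ.map e.toEmbedding, q i = ∏ i, q i := by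
      refine Finset.prod_subset (Finset.subset_univ _) fun i _ hi => ?_
      rw [hq, Function.extend_apply' _ _ _ (by simpa using hi)]; rfl
    rw [← h2, Finset.prod_map]
    refine Finset.prod_congr rfl fun l _ => ?_
    exact e.injective.extend_apply _ _ _
  rw [← hprod, ← Finset.prod_mul_distrib]
  refine Finset.prod_congr rfl fun i _ => ?_
  generalize j.succAbove i = i'
  have hDy : MeasurableSet {z | (y, z) ∈ D i'} := measurable_prodMk_left (hDm i')
  rw [lintegral_ite_one P (p := fun z => (y, z) ∈ D i' ∧ z ∈ A' i') (hDy.inter (hA'm i')), lintegral_ite_one P hDy]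
  change P ({z | (y, z) ∈ D i'} ∩ A' i') = q i' * P {z | (y, z) ∈ D i'}
  -- An index in S contributes P(ball ∩ A_l) = P(A_l | ball) P(ball); any other contributes the same
  -- factor to both sides.
  by_cases hi : ∃ l, e l = i'
  · obtain ⟨l, rfl⟩ := hi
    have hDb : {z | (y, z) ∈ D (e l)} = Metric.ball 0 ‖y‖ := by
      ext z
      simp [hD, (heS (e l)).2 ⟨l, rfl⟩]
    rw [hq, hA', e.injective.extend_apply, e.injective.extend_apply, hDb,
      ballLaw_of_ne_zero P hball, cond_mul_eq_inter measurableSet_ball]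
  · rw [hq, hA', Function.extend_apply' _ _ _ hi, Function.extend_apply' _ _ _ hi]
    simp

/-- Almost surely there is no tie at a distance at which spheres are null. -/
theorem ae_norm_ne {n : ℕ} {G : Set ℝ} (hG : MeasurableSet G)
    (hG0 : ∀ t ∈ G, P (Metric.sphere 0 t) = 0) :
    ∀ᵐ x ∂(Measure.pi fun _ : Fin n => P), ∀ j i, i ≠ j → ‖x j‖ ∈ G → ‖x i‖ ≠ ‖x j‖ := by
  have hm : ∀ j : Fin n, Measurable fun x : Fin n → EuclideanSpace ℝ (Fin m) => x j :=
    fun j => measurable_pi_apply j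
  have key : ∀ j i : Fin n, i ≠ j → ∀ᵐ x ∂(Measure.pi fun _ : Fin n => P),
      ‖x j‖ ∈ G → ‖x i‖ ≠ ‖x j‖ := by
    intro j i hij
    have hind : IndepFun (fun x : Fin n → EuclideanSpace ℝ (Fin m) => x j) (fun x => x i)
        (Measure.pi fun _ => P) :=
      (iIndepFun_pi (X := fun _ (y : EuclideanSpace ℝ (Fin m)) => y)
        fun _ => aemeasurable_id).indepFun hij.symm
    have hmap := (indepFun_iff_map_prod_eq_prod_map_map (hm j).aemeasurable
      (hm i).aemeasurable).1 hind
    rw [show (Measure.pi fun _ : Fin n => P).map (fun x => x j) = P from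
        (measurePreserving_eval (fun _ : Fin n => P) j).map_eq,
      show (Measure.pi fun _ : Fin n => P).map (fun x => x i) = P from
        (measurePreserving_eval (fun _ : Fin n => P) i).map_eq] at hmap
    set N : Set (EuclideanSpace ℝ (Fin m) × EuclideanSpace ℝ (Fin m)) :=
      {p | ‖p.1‖ ∈ G ∧ ‖p.2‖ = ‖p.1‖} with hN
    have hNm : MeasurableSet N := (measurable_fst.norm hG).inter
      (measurableSet_eq_fun measurable_snd.norm measurable_fst.norm)
    -- Every section of the tie set is either empty or a null sphere.
    have hN0 : (P.prod P) N = 0 := by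
      rw [Measure.measure_prod_null hNm]
      refine ae_of_all _ fun y => ?_
      by_cases hy : ‖y‖ ∈ G
      · have : Prod.mk y ⁻¹' N = Metric.sphere 0 ‖y‖ := by
          ext z; simp [hN, hy]
        change P (Prod.mk y ⁻¹' N) = 0
        rw [this]
        exact hG0 _ hy
      · have : Prod.mk y ⁻¹' N = ∅ := by
          ext z; simp [hN, hy]
        change P (Prod.mk y ⁻¹' N) = 0
        rw [this, measure_empty]
    rw [← hmap, Measure.map_apply ((hm j).prodMk (hm i)) hNm] at hN0
    filter_upwards [measure_eq_zero_iff_ae_notMem.1 hN0] with x hx hxG heq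
    exact hx ⟨hxG, heq⟩
  have h := ae_all_iff.2 fun j => ae_all_iff.2 fun i => ae_all_iff.2 (key j i)
  filter_upwards [h] with x hx using hx

end Sample

section Sample

variable {m : ℕ} (P : Measure (EuclideanSpace ℝ (Fin m))) [IsProbabilityMeasure P]

-- Up to the null set of ties, the event is the disjoint union, over pairs (j, S), of the events on
-- which `setLIntegral_strictNeighbor` applies; on each of them distance and neighbors are explicit
-- coordinates.
open Classical in
theorem setLIntegral_nnDist {n k : ℕ} (hk : k < n) {B : Set ℝ} (hB : MeasurableSet B)
    (hB0 : ∀ t ∈ B, P (Metric.ball 0 t) ≠ 0) (hB1 : ∀ t ∈ B, P (Metric.sphere 0 t) = 0)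
    {A : Fin k → Set (EuclideanSpace ℝ (Fin m))} (hA : ∀ l, MeasurableSet (A l)) :
    ∫⁻ x in {x | nnDist x k hk ∈ B},
        (if ∀ l, nearestNeighbors x k hk l ∈ A l then 1 else 0) ∂(Measure.pi fun _ : Fin n => P) =
      ∫⁻ x in {x | nnDist x k hk ∈ B},
        ∏ l, ballLaw P (nnDist x k hk) (A l) ∂(Measure.pi fun _ : Fin n => P) := by
  obtain ⟨n, rfl⟩ : ∃ n', n = n' + 1 := ⟨n - 1, by omega⟩
  set I : Finset (Fin (n + 1) × Finset (Fin (n + 1))) :=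
    Finset.univ.filter fun p => p.2.card = k ∧ p.1 ∉ p.2 with hI
  set T : Fin (n + 1) × Finset (Fin (n + 1)) → Set (Fin (n + 1) → EuclideanSpace ℝ (Fin m)) :=
    fun p => {x | StrictNeighbor x p.1 p.2 ∧ ‖x p.1‖ ∈ B} with hT
  have hcover : ({x | nnDist x k hk ∈ B} : Set (Fin (n + 1) → EuclideanSpace ℝ (Fin m)))
      =ᵐ[Measure.pi fun _ => P] ⋃ p ∈ I, T p := by
    filter_upwards [ae_norm_ne P hB hB1] with x hx
    refine propext ?_
    change nnDist x k hk ∈ B ↔ x ∈ ⋃ p ∈ I, T p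
    simp only [Set.mem_iUnion, hI, Finset.mem_filter, Finset.mem_univ, true_and, exists_prop]
    constructor
    · intro hxB
      refine ⟨(nnOrder x ⟨k, hk⟩, nnIndices x k hk), ⟨card_nnIndices x k hk,
        nnOrder_notMem_nnIndices x hk⟩, ?_, hxB⟩
      exact strictNeighbor_of_forall_ne x hk fun i hi => hx _ i hi hxB
    · rintro ⟨p, ⟨hp, -⟩, hxp, hxB⟩
      rw [nnDist, (hxp.nnOrder_eq hk hp).1]
      exact hxB
  have hdisj : Set.PairwiseDisjoint (I : Set (Fin (n + 1) × Finset (Fin (n + 1)))) T := by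
    intro p hp p' hp' hne
    refine Set.disjoint_left.2 fun x hx hx' => hne ?_
    simp only [hI, Finset.coe_filter, Finset.mem_univ, true_and, Set.mem_ofPred_eq] at hp hp'
    have h1 := hx.1.nnOrder_eq hk hp.1
    have h2 := hx'.1.nnOrder_eq hk hp'.1
    exact Prod.ext (h1.1.symm.trans h2.1) (h1.2.symm.trans h2.2)
  have hTm : ∀ p ∈ I, MeasurableSet (T p) := fun p _ => measurableSet_strictNeighbor _ _ hB
  rw [setLIntegral_congr hcover, setLIntegral_congr hcover, lintegral_biUnion_finset hdisj hTm,
    lintegral_biUnion_finset hdisj hTm]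
  refine Finset.sum_congr rfl fun p hp => ?_
  obtain ⟨hS, hj⟩ : p.2.card = k ∧ p.1 ∉ p.2 := by simpa [hI] using hp
  refine (setLIntegral_congr_fun (hTm p hp) fun x hx => ?_).trans
    ((setLIntegral_strictNeighbor P p.1 p.2 hS hj hB hB0 hA).trans
      (setLIntegral_congr_fun (hTm p hp) fun x hx => ?_))
  · simp only [nearestNeighbors_eq hk hS (hx.1.nnOrder_eq hk hS).2]
  · simp only [nnDist, (hx.1.nnOrder_eq hk hS).1]

/-- Given that the distance to the `(k + 1)`-st nearest neighbour is `s`, the `k` nearest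
neighbours are an i.i.d. sample from the conditional law on the open ball of radius `s`. -/
theorem condDistrib_nearestNeighbors_pi {n k : ℕ} (hk : k < n)
    {ν : Measure (Fin n → EuclideanSpace ℝ (Fin m))} [IsProbabilityMeasure ν]
    (hν : ν = Measure.pi fun _ => P) :
    ∀ᵐ s ∂(ν.map fun x => nnDist x k hk),
      P (Metric.ball 0 s) ≠ 0 → P (Metric.sphere 0 s) = 0 →
      condDistrib (fun x => nearestNeighbors x k hk) (fun x => nnDist x k hk) ν s =
        ballSampleKernel P k s := by
  classical
  have hR : Measurable fun x : Fin n → EuclideanSpace ℝ (Fin m) => nnDist x k hk :=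
    measurable_nnDist hk
  have hY : Measurable fun x : Fin n → EuclideanSpace ℝ (Fin m) => nearestNeighbors x k hk :=
    measurable_nearestNeighbors hk
  set law := ν.map fun x => nnDist x k hk with hlaw
  have : IsProbabilityMeasure law := Measure.isProbabilityMeasure_map hR.aemeasurable
  set κ := condDistrib (fun x => nearestNeighbors x k hk) (fun x => nnDist x k hk) ν with hκ
  set G : Set ℝ := {s | P (Metric.ball 0 s) ≠ 0} ∩ {s | P (Metric.sphere 0 s) = 0} with hG
  have hGm : MeasurableSet G :=
    (measurable_measure_ball P (measurableSet_singleton 0)).compl.inter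
      (measurableSet_measure_sphere_eq_zero P)
  -- The kernels are compared only over G, the radii with non-null ball and null sphere; equal joint
  -- laws force almost everywhere equal kernels.
  suffices h : law.restrict G ⊗ₘ κ = law.restrict G ⊗ₘ ballSampleKernel P k by
    have h1 := (ae_restrict_iff' hGm).1 (Kernel.ae_eq_of_compProd_eq h)
    filter_upwards [h1] with s hs h2 h3 using hs ⟨h2, h3⟩
  have hbox : ∀ B : Set ℝ, MeasurableSet B → B ⊆ G →
      ∀ A : Fin k → Set (EuclideanSpace ℝ (Fin m)), (∀ l, MeasurableSet (A l)) →
      ∫⁻ s in B, κ s (Set.univ.pi A) ∂law = ∫⁻ s in B, ballSampleKernel P k s (Set.univ.pi A) ∂law := by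
    intro B hB hBG A hA
    have hAm : MeasurableSet (Set.univ.pi A) := MeasurableSet.univ_pi hA
    have h1 := setLIntegral_nnDist P hk hB (fun t ht => (hBG ht).1) (fun t ht => (hBG ht).2) hA
    rw [← hν] at h1
    have h2 : ∫⁻ s in B, κ s (Set.univ.pi A) ∂law =
        ν ({x | nnDist x k hk ∈ B} ∩ {x | nearestNeighbors x k hk ∈ Set.univ.pi A}) := by
      rw [← Measure.compProd_apply_prod hB hAm, hlaw, hκ, compProd_map_condDistrib hY.aemeasurable,
        Measure.map_apply (hR.prodMk hY) (hB.prod hAm)]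
      rfl
    have h3 : ∫⁻ s in B, ballSampleKernel P k s (Set.univ.pi A) ∂law =
        ∫⁻ x in {x | nnDist x k hk ∈ B}, ∏ l, ballLaw P (nnDist x k hk) (A l) ∂ν := by
      rw [hlaw, setLIntegral_map hB (Kernel.measurable_coe _ hAm) hR]
      simp only [ballSampleKernel_apply, Measure.pi_pi]
      rfl
    rw [h2, h3, ← h1, lintegral_ite_one]
    · rw [Measure.restrict_apply, Set.inter_comm]
      · simp only [Set.mem_univ_pi]
      · exact hY hAm |>.congr (by ext; simp)
    · exact hY hAm |>.congr (by ext; simp)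
  refine Measure.ext_prod fun {B A} hB hA => ?_
  rw [Measure.compProd_apply_prod hB hA, Measure.compProd_apply_prod hB hA,
    Measure.restrict_restrict hB]
  set lawB := law.restrict (B ∩ G) with hlawB
  -- With the set of radii fixed, both sides are finite measures of the same mass in the remaining
  -- variable, so agreement on boxes suffices.
  have hbind : κ ∘ₘ lawB = ballSampleKernel P k ∘ₘ lawB := by
    refine ext_of_generate_finite _ generateFrom_pi.symm isPiSystem_pi ?_ ?_
    · rintro _ ⟨A, hA, rfl⟩
      have hA' : ∀ l, MeasurableSet (A l) := fun l => hA l (Set.mem_univ l)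
      rw [Measure.bind_apply (MeasurableSet.univ_pi hA') κ.aemeasurable,
        Measure.bind_apply (MeasurableSet.univ_pi hA') (Kernel.aemeasurable _)]
      exact hbox _ (hB.inter hGm) Set.inter_subset_right A hA'
    · simp [Measure.bind_apply MeasurableSet.univ (Kernel.aemeasurable _)]
  have := DFunLike.congr_fun hbind A
  rwa [Measure.bind_apply hA κ.aemeasurable, Measure.bind_apply hA (Kernel.aemeasurable _)] at this

/-- The conditional distribution depends only on the joint law of the sample, which is the product
measure by independence. -/
theorem condDistrib_nearestNeighbors {Ω : Type*} [MeasurableSpace Ω] {μ : Measure Ω}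
    [IsProbabilityMeasure μ] {X : ℕ → Ω → EuclideanSpace ℝ (Fin m)} (hX : ∀ i, Measurable (X i))
    (hind : iIndepFun X μ) (hlaw : ∀ i, μ.map (X i) = P) {n k : ℕ} (hk : k < n) :
    ∀ᵐ s ∂(μ.map (fun ω => nnDist (fun i : Fin n => X i ω) k hk)),
      P (Metric.ball 0 s) ≠ 0 → P (Metric.sphere 0 s) = 0 →
      condDistrib (fun ω => nearestNeighbors (fun i : Fin n => X i ω) k hk)
        (fun ω => nnDist (fun i : Fin n => X i ω) k hk) μ s =
      Measure.pi fun _ : Fin k => P[|Metric.ball 0 s] := by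
  set V : Ω → Fin n → EuclideanSpace ℝ (Fin m) := fun ω i => X i ω with hV
  have hVm : Measurable V := measurable_pi_lambda _ fun i => hX i
  have hmap : μ.map V = Measure.pi fun _ : Fin n => P := by
    have hind' : iIndepFun (fun i : Fin n => X i) μ := hind.precomp Fin.val_injective
    have h := iIndepFun.map_fun_eq_pi_map (f := fun i : Fin n => X i)
      (fun i => (hX i).aemeasurable) hind'
    simpa only [hlaw] using h
  have : IsProbabilityMeasure (μ.map V) := Measure.isProbabilityMeasure_map hVm.aemeasurable
  have h1 := condDistrib_nearestNeighbors_pi P hk hmap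
  have h2 := condDistrib_map (ν := μ) (f := V) (X := fun x => nnDist x k hk)
    (Y := fun x => nearestNeighbors x k hk) (measurable_nnDist hk).aemeasurable
    (measurable_nearestNeighbors hk).aemeasurable hVm.aemeasurable
  rw [Measure.map_map (measurable_nnDist hk) hVm] at h1
  filter_upwards [h1, h2] with s hs1 hs2 hb hsph
  have h3 := hs2.symm.trans (hs1 hb hsph)
  rw [ballSampleKernel_apply, ballLaw_of_ne_zero P hb] at h3
  exact h3

end Sample

/-! ### From the density on M to masses of balls and spheres -/

section Density

variable {m d : ℕ} {M : Set (EuclideanSpace ℝ (Fin m))} {g : EuclideanSpace ℝ (Fin m) → ℝ}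

theorem submanifoldVolume_restrict_inter (hM : MeasurableSet M)
    {B : Set (EuclideanSpace ℝ (Fin m))} (hB : MeasurableSet B) :
    (submanifoldVolume d M).restrict (M ∩ B) = (submanifoldVolume d M).restrict B := by
  rw [submanifoldVolume, Measure.restrict_restrict (hM.inter hB), Measure.restrict_restrict hB,
    Set.inter_right_comm, Set.inter_self, Set.inter_comm]

theorem setLIntegral_submanifoldVolume (hM : MeasurableSet M)
    {B : Set (EuclideanSpace ℝ (Fin m))} (hB : MeasurableSet B) :
    ∫⁻ y in M ∩ B, ENNReal.ofReal (g y) ∂(submanifoldVolume d M) = densityMeasure d M g B := by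
  rw [submanifoldVolume_restrict_inter hM hB, densityMeasure, withDensity_apply _ hB]

theorem ball_subset_eball {E : Type*} [PseudoMetricSpace E] (x : E) {s : ℝ} {ρ : ℝ≥0∞}
    (h : ENNReal.ofReal s ≤ ρ) : Metric.ball x s ⊆ Metric.eball x ρ := by
  rw [← Metric.eball_ofReal]
  exact Metric.eball_subset_eball h

theorem densityMeasure_eq_of_subset {P : Measure (EuclideanSpace ℝ (Fin m))} {ρ : ℝ≥0∞}
    (hP : P.restrict (Metric.eball 0 ρ) = (densityMeasure d M g).restrict (Metric.eball 0 ρ))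
    {B : Set (EuclideanSpace ℝ (Fin m))} (hB : B ⊆ Metric.eball 0 ρ) :
    P B = densityMeasure d M g B := by
  rw [← Measure.restrict_eq_self P hB, hP, Measure.restrict_eq_self _ hB]

/-- The ball lies where P has density g, so both the integral over a set and the normalizing
integral are P-masses. -/
theorem restrictedLaw_eq_cond (hM : MeasurableSet M) (hg : Measurable g)
    {P : Measure (EuclideanSpace ℝ (Fin m))} {ρ : ℝ≥0∞}
    (hP : P.restrict (Metric.eball 0 ρ) = (densityMeasure d M g).restrict (Metric.eball 0 ρ))
    {s : ℝ} (hs : ENNReal.ofReal s < ρ) :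
    restrictedLaw d M g s = P[|Metric.ball 0 s] := by
  have hsub := ball_subset_eball (0 : EuclideanSpace ℝ (Fin m)) hs.le
  ext A hA
  rw [cond_apply measurableSet_ball, restrictedLaw, withDensity_apply _ hA]
  have hmeas : Measurable ((M ∩ Metric.ball 0 s).indicator fun y => ENNReal.ofReal (g y)) :=
    hg.ennreal_ofReal.indicator (hM.inter measurableSet_ball)
  simp only [restrictedDensity, div_eq_mul_inv]
  rw [lintegral_mul_const _ hmeas, setLIntegral_indicator (hM.inter measurableSet_ball),
    Set.inter_assoc, setLIntegral_submanifoldVolume hM measurableSet_ball,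
    setLIntegral_submanifoldVolume hM (measurableSet_ball.inter hA),
    densityMeasure_eq_of_subset hP hsub,
    densityMeasure_eq_of_subset hP (Set.inter_subset_left.trans hsub), mul_comm]

/-- By continuity g exceeds g(0)/2 on M near 0, which scales the volume bound. The constant involves
only d and g(0); everything else enters through r₀. -/
theorem IsC2Submanifold.exists_measure_ball_ge (hdm : d ≤ m) (hM : IsC2Submanifold d M)
    (h0 : 0 ∈ M) {ε : ℝ} (hε : 0 < ε) (hcont : ContinuousOn g (M ∩ Metric.ball 0 ε))
    (hg0 : 0 < g 0) {P : Measure (EuclideanSpace ℝ (Fin m))} {ρ : ℝ≥0∞} (hρ : 0 < ρ)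
    (hP : P.restrict (Metric.eball 0 ρ) = (densityMeasure d M g).restrict (Metric.eball 0 ρ)) :
    ∃ r₀ : ℝ, 0 < r₀ ∧ ∀ r : ℝ, 0 < r → r ≤ r₀ →
      ENNReal.ofReal (ballVolumeConst d * (g 0 / 2) * r ^ d) ≤ P (Metric.ball 0 r) := by
  obtain ⟨q, hq0, hqρ⟩ := ENNReal.lt_iff_exists_nnreal_btwn.1 hρ
  obtain ⟨r₁, hr₁, hvol⟩ := hM.volume_ball_ge hdm h0
  have hev : ∀ᶠ x in 𝓝[M ∩ Metric.ball 0 ε] 0, g 0 / 2 < g x :=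
    (hcont 0 ⟨h0, Metric.mem_ball_self hε⟩).eventually_const_lt (by linarith)
  obtain ⟨δ, hδ, hsub⟩ := Metric.mem_nhdsWithin_iff.1 hev
  refine ⟨min (min r₁ q) (min δ ε), by
    have : (0 : ℝ) < q := by exact_mod_cast hq0
    positivity, fun r hr hr0 => ?_⟩
  simp only [le_min_iff] at hr0
  obtain ⟨⟨hrr, hrq⟩, hrδ, hrε⟩ := hr0
  have hball : Metric.ball (0 : EuclideanSpace ℝ (Fin m)) r ⊆ Metric.eball 0 ρ := by
    refine ball_subset_eball _ (le_trans ?_ hqρ.le)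
    rw [← ENNReal.ofReal_coe_nnreal]
    exact ENNReal.ofReal_le_ofReal hrq
  have hMm := hM.measurableSet
  rw [densityMeasure_eq_of_subset hP hball, ← setLIntegral_submanifoldVolume hMm measurableSet_ball]
  calc ENNReal.ofReal (ballVolumeConst d * (g 0 / 2) * r ^ d)
      = ENNReal.ofReal (g 0 / 2) * ENNReal.ofReal (ballVolumeConst d * r ^ d) := by
        rw [← ENNReal.ofReal_mul (by linarith)]
        congr 1; ring
    _ ≤ ENNReal.ofReal (g 0 / 2) * submanifoldVolume d M (Metric.ball 0 r) := by
        gcongr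
        exact hvol r hr hrr
    _ = ∫⁻ _ in M ∩ Metric.ball 0 r, ENNReal.ofReal (g 0 / 2) ∂(submanifoldVolume d M) := by
        rw [submanifoldVolume_restrict_inter hMm measurableSet_ball, setLIntegral_const]
    _ ≤ _ := by
        refine setLIntegral_mono' (hMm.inter measurableSet_ball) fun x hx => ?_
        refine ENNReal.ofReal_le_ofReal (le_of_lt (hsub ⟨Metric.ball_subset_ball hrδ hx.2, hx.1,
          Metric.ball_subset_ball hrε hx.2⟩))

theorem IsC2Submanifold.exists_measure_sphere_eq_zero (hd : 1 ≤ d) (hdm : d ≤ m)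
    (hM : IsC2Submanifold d M) (h0 : 0 ∈ M) {P : Measure (EuclideanSpace ℝ (Fin m))} {ρ : ℝ≥0∞}
    (hρ : 0 < ρ)
    (hP : P.restrict (Metric.eball 0 ρ) = (densityMeasure d M g).restrict (Metric.eball 0 ρ)) :
    ∃ ρ₀ : ℝ, 0 < ρ₀ ∧ ∀ s : ℝ, s < ρ₀ → P (Metric.sphere 0 s) = 0 := by
  obtain ⟨q, hq0, hqρ⟩ := ENNReal.lt_iff_exists_nnreal_btwn.1 hρ
  obtain ⟨r₁, hr₁, hvol⟩ := hM.volume_sphere_eq_zero hd hdm h0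
  have hq : (0 : ℝ) < q := by exact_mod_cast hq0
  refine ⟨min r₁ q, lt_min hr₁ hq, fun s hs => ?_⟩
  have hsub : Metric.sphere (0 : EuclideanSpace ℝ (Fin m)) s ⊆ Metric.eball 0 ρ := by
    intro x hx
    refine ball_subset_eball 0 (s := q) (by rw [ENNReal.ofReal_coe_nnreal]; exact hqρ.le) ?_
    rw [mem_ball_zero_iff, mem_sphere_zero_iff_norm.1 hx]
    exact hs.trans_le (min_le_right _ _)
  rw [densityMeasure_eq_of_subset hP hsub]
  exact withDensity_absolutelyContinuous _ _ (hvol s (hs.trans_le (min_le_left _ _)))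

end Density

/-! ### Assembly -/

/-- If the law of the sample does not charge the origin, the distance to the `(k + 1)`-st nearest
neighbour is almost surely positive. -/
theorem ae_map_nnDist_pos {m : ℕ} {P : Measure (EuclideanSpace ℝ (Fin m))} (hP : P {0} = 0)
    {Ω : Type*} [MeasurableSpace Ω] {μ : Measure Ω} {X : ℕ → Ω → EuclideanSpace ℝ (Fin m)}
    (hX : ∀ i, Measurable (X i)) (hlaw : ∀ i, μ.map (X i) = P) {n k : ℕ} (hk : k < n) :
    ∀ᵐ s ∂(μ.map (fun ω => nnDist (fun i : Fin n => X i ω) k hk)), 0 < s := by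
  have hV : Measurable fun ω (i : Fin n) => X i ω := measurable_pi_lambda _ fun i => hX i
  have hm : Measurable fun ω => nnDist (fun i : Fin n => X i ω) k hk := by
    have h := (measurable_nnDist (m := m) hk).comp hV
    simpa only [Function.comp_def] using h
  have h : ∀ i, ∀ᵐ ω ∂μ, X i ω ≠ 0 := fun i => by
    have h1 : ∀ᵐ x ∂(μ.map (X i)), x ∉ ({0} : Set (EuclideanSpace ℝ (Fin m))) := by
      rw [hlaw i]
      exact measure_eq_zero_iff_ae_notMem.1 hP
    exact (ae_of_ae_map (hX i).aemeasurable h1).mono fun ω hω h0 => hω h0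
  have hpos : ∀ᵐ ω ∂μ, 0 < nnDist (fun i : Fin n => X i ω) k hk := by
    filter_upwards [ae_all_iff.2 h] with ω hω
    rw [nnDist, norm_pos_iff]
    exact hω _
  exact (ae_map_iff (p := fun s : ℝ => 0 < s) hm.aemeasurable measurableSet_Ioi).2 hpos

theorem isBigO_rpow_log_div {d : ℕ} (K : ℝ) (hK : 0 ≤ K) :
    (fun n : ℕ => (K * (Real.log n / n)) ^ ((1 : ℝ) / d)) =O[atTop]
      fun n : ℕ => (Real.log (n : ℝ) / (n : ℝ)) ^ ((1 : ℝ) / (d : ℝ)) := by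
  refine IsBigO.of_bound (K ^ ((1 : ℝ) / d)) (Eventually.of_forall fun n => ?_)
  have h : 0 ≤ Real.log n / n := div_nonneg (Real.log_natCast_nonneg n) n.cast_nonneg
  rw [Real.mul_rpow hK h, norm_mul, Real.norm_of_nonneg (Real.rpow_nonneg hK _)]

theorem mainTheorem7 (m d : ℕ) (hd : 1 ≤ d) (hdm : d < m) :
    ∃ C₀ : ℝ, 0 < C₀ ∧ ∃ r : ℝ → ℝ → ℕ → ℝ,
      -- the bound `r` depends only on the value `g 0` of the density at `0`, on `C` and on `n`
      (∀ g₀ : ℝ, 0 < g₀ → ∀ C : ℝ, C₀ ≤ C →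
        (fun n : ℕ => r g₀ C n) =O[atTop]
          (fun n : ℕ => (Real.log (n : ℝ) / (n : ℝ)) ^ ((1 : ℝ) / (d : ℝ)))) ∧
      ∀ (M : Set (EuclideanSpace ℝ (Fin m))) (_ : IsC2Submanifold d M)
        (_ : (0 : EuclideanSpace ℝ (Fin m)) ∈ M)
        (g : EuclideanSpace ℝ (Fin m) → ℝ) (_ : Measurable g) (_ : ∀ x ∈ M, 0 ≤ g x)
        -- near `0`, the density is Lipschitz on `M`, and it does not vanish at `0`
        (_ : ∃ ε : ℝ, 0 < ε ∧ ∃ K : NNReal, LipschitzOnWith K g (M ∩ Metric.ball 0 ε))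
        (_ : 0 < g 0)
        (P : Measure (EuclideanSpace ℝ (Fin m))) (_ : IsProbabilityMeasure P)
        -- on the open ball of radius `ρ ∈ (0, ∞]`, the law `P` lives on `M` with density `g`
        (ρ : ℝ≥0∞) (_ : 0 < ρ)
        (_ : P.restrict (Metric.eball 0 ρ) =
          (densityMeasure d M g).restrict (Metric.eball 0 ρ)),
        -- small spheres around `0` are `P`-null
        (∃ ρ₀ : ℝ, 0 < ρ₀ ∧ ∀ s : ℝ, s < ρ₀ → P (Metric.sphere 0 s) = 0) ∧
        ∀ (Ω : Type*) [MeasurableSpace Ω] (μ : Measure Ω) [IsProbabilityMeasure μ]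
          (X : ℕ → Ω → EuclideanSpace ℝ (Fin m)) (_ : ∀ i, Measurable (X i))
          (_ : iIndepFun X μ) (_ : ∀ i, μ.map (X i) = P),
          -- (1)
          (∀ C : ℝ, C₀ ≤ C → ∀ᵐ ω ∂μ, ∀ᶠ n : ℕ in atTop,
            ∃ hk : ⌈C * Real.log (n : ℝ)⌉₊ < n,
              nnDist (fun i : Fin n => X i ω) ⌈C * Real.log (n : ℝ)⌉₊ hk ≤ r (g 0) C n) ∧
          -- (2)
          (∀ (n k : ℕ) (hk : k < n),
            ∀ᵐ s ∂(μ.map (fun ω => nnDist (fun i : Fin n => X i ω) k hk)),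
              ENNReal.ofReal s < ρ → P (Metric.sphere 0 s) = 0 →
              condDistrib (fun ω => nearestNeighbors (fun i : Fin n => X i ω) k hk)
                (fun ω => nnDist (fun i : Fin n => X i ω) k hk) μ s =
              Measure.pi (fun _ : Fin k => restrictedLaw d M g s)) := by
  have hκ := ballVolumeConst_pos d
  -- C₀ = 1 is what the summability of the Chernoff bounds requires; the denominator is the mass
  -- constant of `exists_measure_ball_ge` with g(0) = g₀.
  refine ⟨1, one_pos, fun g₀ C n =>
    (6 * C / (ballVolumeConst d * (g₀ / 2)) * (Real.log n / n)) ^ ((1 : ℝ) / d),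
    fun g₀ hg₀ C hC => isBigO_rpow_log_div _ (by positivity), ?_⟩
  intro M hM h0 g hg _ ⟨ε, hε, K, hlip⟩ hg0 P hPprob ρ hρ hP
  obtain ⟨ρ₀, hρ₀, hsphere⟩ := hM.exists_measure_sphere_eq_zero hd hdm.le h0 hρ hP
  obtain ⟨r₀, hr₀, hmass⟩ :=
    hM.exists_measure_ball_ge hdm.le h0 hε hlip.continuousOn hg0 hρ hP
  have hball : ∀ s : ℝ, 0 < s → P (Metric.ball 0 s) ≠ 0 := by
    intro s hs
    have h1 := hmass (min s r₀) (lt_min hs hr₀) (min_le_right _ _)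
    have h2 : 0 < ENNReal.ofReal (ballVolumeConst d * (g 0 / 2) * min s r₀ ^ d) := by
      have := lt_min hs hr₀
      rw [ENNReal.ofReal_pos]
      positivity
    exact ((h2.trans_le h1).trans_le (measure_mono (Metric.ball_subset_ball (min_le_left _ _)))).ne'
  refine ⟨⟨ρ₀, hρ₀, hsphere⟩, ?_⟩
  intro Ω _ μ _ X hX hind hlaw
  refine ⟨fun C hC => ?_, fun n k hk => ?_⟩
  · exact ae_eventually_nnDist_le hd (by positivity) hr₀ hmass hX hind hlaw hC
  -- The origin is the sphere of radius 0, hence null; so almost every s is positive and its ball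
  -- has positive mass.
  · have hP0 : P {0} = 0 := by simpa using hsphere 0 hρ₀
    filter_upwards [condDistrib_nearestNeighbors P hX hind hlaw hk,
      ae_map_nnDist_pos hP0 hX hlaw hk] with s hs hpos hsρ hsph
    rw [hs (hball s hpos) hsph, restrictedLaw_eq_cond hM.measurableSet hg hP hsρ]
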